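/- Let $k$ be an algebraically closed field of characteristic two. A cubic surface is a subscheme $X=V(f)\subset\mathbb P^3_k$ defined by a single homogeneous polynomial $f\in k[x,y,z,w]$ of degree three. It is Frobenius split if the map of $\mathcal O_X$-modules $\mathcal O_X\to F_*\mathcal O_X$ given by the Frobenius morphism $F$ of $X$ splits. Call $X$ triangle-free if for every collection of coplanar lines lying on $X$ there is a point of $\mathbb P^3$ that lies on all of them. (1) A smooth cubic surface $X\subset\mathbb P^3_k$ is Frobenius split if and only if it is not triangle-free. (2) The Fermat cubic surface $x^3+y^3+z^3+w^3=0$ is smooth and is not Frobenius split, and every smooth cubic surface in $\mathbb P^3_k$ that is not Frobenius split is projectively equivalent to it (that is, its equation becomes a nonzero scalar multiple of $x^3+y^3+z^3+w^3$ after an invertible linear change of coordinates). -/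

import Mathlib

open AlgebraicGeometry

universe u

namespace CubicSurface

section QuotientGrading

attribute [local instance] MvPolynomial.gradedAlgebra

variable {k : Type u} [Field k]

/-- The degree `n` part of the homogeneous coordinate ring `k[x₀, x₁, x₂, x₃] / (f)`: the image of
the forms of degree `n`. -/
noncomputable def coordGrading (f : MvPolynomial (Fin 4) k) (n : ℕ) :
    Submodule k (MvPolynomial (Fin 4) k ⧸ Ideal.span {f}) :=
  (MvPolynomial.homogeneousSubmodule (Fin 4) k n).map
    (Ideal.Quotient.mkₐ k (Ideal.span {f})).toLinearMap

theorem mk_mem_coordGrading (f : MvPolynomial (Fin 4) k) {n : ℕ} {p : MvPolynomial (Fin 4) k}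
    (hp : p ∈ MvPolynomial.homogeneousSubmodule (Fin 4) k n) :
    Ideal.Quotient.mkₐ k (Ideal.span {f}) p ∈ coordGrading f n := ⟨p, hp, rfl⟩

instance coordGrading_gradedMonoid (f : MvPolynomial (Fin 4) k) :
    SetLike.GradedMonoid (coordGrading f) where
  one_mem := ⟨1, MvPolynomial.isHomogeneous_one _ _, map_one (Ideal.Quotient.mkₐ k _)⟩
  mul_mem := by
    rintro i j _ _ ⟨a, ha, rfl⟩ ⟨b, hb, rfl⟩
    exact ⟨a * b, MvPolynomial.IsHomogeneous.mul ha hb, map_mul (Ideal.Quotient.mkₐ k _) a b⟩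

/-- The map taking a polynomial to the family of the classes of its homogeneous components. -/
noncomputable def toCoordSum (f : MvPolynomial (Fin 4) k) :
    MvPolynomial (Fin 4) k →ₗ[k] DirectSum ℕ fun n => coordGrading f n :=
  (DirectSum.toModule k ℕ _ fun n => (DirectSum.lof k ℕ (fun n => coordGrading f n) n) ∘ₗ
      (((Ideal.Quotient.mkₐ k (Ideal.span {f})).toLinearMap ∘ₗ
        (MvPolynomial.homogeneousSubmodule (Fin 4) k n).subtype).codRestrict (coordGrading f n)
          fun p => mk_mem_coordGrading f p.2)) ∘ₗ
    (DirectSum.decomposeLinearEquiv (MvPolynomial.homogeneousSubmodule (Fin 4) k)).toLinearMap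

theorem toCoordSum_of_mem (f : MvPolynomial (Fin 4) k) {n : ℕ} {p : MvPolynomial (Fin 4) k}
    (hp : p ∈ MvPolynomial.homogeneousSubmodule (Fin 4) k n) :
    toCoordSum f p = DirectSum.lof k ℕ (fun n => coordGrading f n) n
      ⟨Ideal.Quotient.mkₐ k (Ideal.span {f}) p, mk_mem_coordGrading f hp⟩ := by
  rw [toCoordSum, LinearMap.comp_apply, LinearEquiv.coe_coe, DirectSum.decomposeLinearEquiv_apply,
    DirectSum.decompose_of_mem _ hp, ← DirectSum.lof_eq_of k, DirectSum.toModule_lof]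
  rfl

theorem toCoordSum_eq_zero {f p : MvPolynomial (Fin 4) k} {d : ℕ} (hf : f.IsHomogeneous d)
    (hp : p ∈ Ideal.span {f}) : toCoordSum f p = 0 := by
  obtain ⟨a, rfl⟩ := Ideal.mem_span_singleton'.mp hp
  clear hp
  induction a using DirectSum.Decomposition.inductionOn
    (MvPolynomial.homogeneousSubmodule (Fin 4) k) with
  | zero => simp
  | add a b ha hb => rw [add_mul, map_add, ha, hb, add_zero]
  | @homogeneous i m =>
    have h : (m : MvPolynomial (Fin 4) k) * f ∈
        MvPolynomial.homogeneousSubmodule (Fin 4) k (i + d) := MvPolynomial.IsHomogeneous.mul m.2 hf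
    have h0 : Ideal.Quotient.mkₐ k (Ideal.span {f}) ((m : MvPolynomial (Fin 4) k) * f) = 0 :=
      Ideal.Quotient.eq_zero_iff_mem.mpr (Ideal.mem_span_singleton'.mpr ⟨_, rfl⟩)
    rw [toCoordSum_of_mem f h]
    simp only [h0]
    exact map_zero _

/-- The decomposition of an element of the coordinate ring into its homogeneous components. -/
noncomputable def coordDecompose (f : MvPolynomial (Fin 4) k) {d : ℕ} (hf : f.IsHomogeneous d) :
    (MvPolynomial (Fin 4) k ⧸ Ideal.span {f}) →ₗ[k] DirectSum ℕ fun n => coordGrading f n where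
  toFun := Quotient.lift (toCoordSum f) (by
    intro a b hab
    have h := toCoordSum_eq_zero hf ((Submodule.quotientRel_def _).mp hab)
    exact sub_eq_zero.mp ((map_sub (toCoordSum f) a b).symm.trans h))
  map_add' := by
    rintro ⟨a⟩ ⟨b⟩
    exact map_add (toCoordSum f) a b
  map_smul' := by
    rintro c ⟨a⟩
    exact map_smul (toCoordSum f) c a

theorem coordDecompose_mk (f : MvPolynomial (Fin 4) k) {d : ℕ} (hf : f.IsHomogeneous d)
    (p : MvPolynomial (Fin 4) k) :
    coordDecompose f hf (Ideal.Quotient.mkₐ k _ p) = toCoordSum f p := rfl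

/-- The homogeneous coordinate ring of the hypersurface `f = 0` is graded. -/
@[reducible] noncomputable def coordGradedAlgebra (f : MvPolynomial (Fin 4) k) {d : ℕ}
    (hf : f.IsHomogeneous d) : GradedAlgebra (coordGrading f) :=
  { coordGrading_gradedMonoid f with
    toDecomposition := DirectSum.Decomposition.ofLinearMap (coordGrading f) (coordDecompose f hf)
      (by
        refine LinearMap.ext fun q => ?_
        obtain ⟨p, rfl⟩ := Ideal.Quotient.mkₐ_surjective k _ q
        induction p using DirectSum.Decomposition.inductionOn
          (MvPolynomial.homogeneousSubmodule (Fin 4) k) with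
        | zero => simp
        | add a b ha hb => rw [map_add, map_add, ha, hb, map_add]
        | homogeneous m =>
          rw [LinearMap.comp_apply, coordDecompose_mk, toCoordSum_of_mem f m.2,
            DirectSum.coeLinearMap_lof]
          rfl)
      (by
        refine DirectSum.linearMap_ext _ fun i => LinearMap.ext ?_
        rintro ⟨_, m, hm, rfl⟩
        rw [LinearMap.comp_apply, LinearMap.comp_apply, DirectSum.coeLinearMap_lof]
        exact (coordDecompose_mk f hf m).trans (toCoordSum_of_mem f hm)) }

end QuotientGrading

/-- The hypersurface of degree `d` in projective three-space over `k` cut out by the form `f`, as a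
scheme: `Proj k[x₀, x₁, x₂, x₃] / (f)`. -/
noncomputable def surface {k : Type u} [Field k] (f : MvPolynomial (Fin 4) k) {d : ℕ}
    (hf : f.IsHomogeneous d) : Scheme.{u} :=
  letI := coordGradedAlgebra f hf
  Proj (coordGrading f)

/-- A scheme `X` of prime characteristic `p` is Frobenius split if the map of `𝒪_X`-modules
`𝒪_X → F_* 𝒪_X` given by the `p`-th power map on functions has a left inverse. As `F` is the
identity on the underlying space, `F_* 𝒪_X` is the sheaf `𝒪_X` on which a function `a` acts as
multiplication by `a ^ p`. So a left inverse is a family `φ` of additive self-maps of the groups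
`Γ(X, U)` that commutes with restriction, satisfies `φ (a ^ p * b) = a * φ b` (it is linear) and
`φ (a ^ p) = a` (it undoes the Frobenius map). -/
def IsFrobeniusSplit (p : ℕ) (X : Scheme.{u}) : Prop :=
  ∃ φ : ∀ U : X.Opens, Γ(X, U) →+ Γ(X, U),
    (∀ (U V : X.Opens) (h : V ≤ U) (a : Γ(X, U)),
      φ V (X.presheaf.map (CategoryTheory.homOfLE h).op a) =
        X.presheaf.map (CategoryTheory.homOfLE h).op (φ U a)) ∧
    (∀ (U : X.Opens) (a b : Γ(X, U)), φ U (a ^ p * b) = a * φ U b) ∧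
    (∀ (U : X.Opens) (a : Γ(X, U)), φ U (a ^ p) = a)

/-- The surface `f = 0` in projective three-space over an algebraically closed field is smooth: at
no point of it do all the partial derivatives of `f` vanish. -/
def IsSmooth {k : Type u} [Field k] (f : MvPolynomial (Fin 4) k) : Prop :=
  ∀ v : Fin 4 → k, v ≠ 0 → MvPolynomial.eval v f = 0 →
    ∃ i, MvPolynomial.eval v (MvPolynomial.pderiv i f) ≠ 0

/-- A line of projective three-space (a two-dimensional subspace of `k⁴`) that lies on the surface
`f = 0`. -/
def IsLineOn {k : Type u} [Field k] (f : MvPolynomial (Fin 4) k)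
    (L : Submodule k (Fin 4 → k)) : Prop :=
  Module.finrank k L = 2 ∧ ∀ v ∈ L, MvPolynomial.eval v f = 0

/-- Some plane of projective three-space contains all the lines of the collection `S`. -/
def Coplanar {k : Type u} [Field k] (S : Set (Submodule k (Fin 4 → k))) : Prop :=
  ∃ H : Submodule k (Fin 4 → k), Module.finrank k H = 3 ∧ ∀ L ∈ S, L ≤ H

/-- Some point of projective three-space lies on all the lines of the collection `S`. -/
def Concurrent {k : Type u} [Field k] (S : Set (Submodule k (Fin 4 → k))) : Prop :=
  ∃ v : Fin 4 → k, v ≠ 0 ∧ ∀ L ∈ S, v ∈ L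

/-- Every collection of coplanar lines on the surface `f = 0` is concurrent. -/
def IsTriangleFree {k : Type u} [Field k] (f : MvPolynomial (Fin 4) k) : Prop :=
  ∀ S : Set (Submodule k (Fin 4 → k)), (∀ L ∈ S, IsLineOn f L) → Coplanar S → Concurrent S

/-- The forms `f` and `g` define the same surface up to a projective change of coordinates. -/
def ProjectivelyEquivalent {k : Type u} [Field k] (f g : MvPolynomial (Fin 4) k) : Prop :=
  ∃ (A : GL (Fin 4) k) (c : kˣ),
    MvPolynomial.aeval
      (fun i => ∑ j, MvPolynomial.C ((A : Matrix (Fin 4) (Fin 4) k) i j) * MvPolynomial.X j) f =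
        MvPolynomial.C (c : k) * g

/-- The Fermat cubic `x³ + y³ + z³ + w³`. -/
noncomputable def fermat (k : Type u) [Field k] : MvPolynomial (Fin 4) k :=
  ∑ i, MvPolynomial.X i ^ 3

theorem fermat_isHomogeneous (k : Type u) [Field k] : (fermat k).IsHomogeneous 3 :=
  MvPolynomial.IsHomogeneous.sum _ _ _ fun i _ => MvPolynomial.isHomogeneous_X_pow i 3

end CubicSurface

/-!
Over an algebraically closed field `k` of characteristic two, a cubic form in four variables is

  `f = ∑ aᵢⱼ xᵢ² xⱼ + ∑ tᵢ ∏_{j ≠ i} xⱼ`,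

and everything is governed by the vector `t`, the *pole* of `f`. Its invariant meaning is that the
trilinear form of second differences of `f` is alternating in characteristic two, and hence is
`T(u, v, w) = det (t, u, v, w)`. For a smooth surface, being Frobenius split, containing a triangle
of lines, and not being equivalent to the Fermat surface are each equivalent to `t ≠ 0`.

*Nonzero pole.* The dual of the Frobenius map of the polynomial ring is generated by the trace
`frobTrace`, the inverse Frobenius applied to `∂₀∂₁∂₂∂₃`. As `∂₀∂₁∂₂∂₃ (f xᵢ) = tᵢ`, the map
`g ↦ frobTrace (tᵢ⁻¹ f xᵢ g)` descends to the homogeneous coordinate ring, and it splits Frobenius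
there and on `Proj` (`isFrobeniusSplit_cubicForm`). A triangle is found in three steps. There is a
line: in a normalized frame the equations for a line reduce to one polynomial equation in one
variable, of degree 27, whose derivative is visibly nonzero
(`CubicPolar.Smooth.exists_line_of_D_pole_eq_zero`,
`CubicPolar.Smooth.exists_line_of_D_pole_ne_zero`). If the line passes through the pole, another
line does not (`CubicPolar.Smooth.exists_line_avoiding_pole`). Finally, for a line `L` that avoids
the pole, some plane through `L` cuts the surface in `L` and a conic with a singular point `q` off
`L`; the tangent cone at `q` meets `L` in two different points, because the middle coefficient of
the restriction to `L` of `u ↦ D(u, q)` is `T(·, ·, q) ≠ 0` (`CubicPolar.Smooth.exists_triangle`).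

*Zero pole.* Now `f(u) = B(u, u)` with `B(u, v) = ∑ aᵢⱼ uᵢ² vⱼ`, and smoothness says that `B` is
nondegenerate. The vectors `v` with `B(w, v) = B(v, w)²` for all `w` are the fixed vectors of a
semilinear bijection, so they span `k⁴` by a theorem of Lang and Dieudonné (`span_fixed_eq_top`).
They form a vector space over the field with four elements on which `B` is Hermitian, and an
orthonormal basis of it turns `f` into the Fermat cubic (`IsSmooth.exists_aeval_eq_fermat`). The
form `B` vanishes on every line of the surface, so a triangle in a plane `H` would make `B` vanish on
`H × H`, which a nondegenerate form does not allow (`IsSmooth.isTriangleFree`). If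
`f = l₀³ + l₁³ + l₂³ + l₃³`, the function `e = l₃² / (l₁ l₂)` has
`e² = (l₀ / l₁)² (l₀ l₃ / l₂²) + l₁ l₃ / l₂² + l₂ l₃ / l₁²`. A Frobenius splitting, applied to `e²`,
would write `e` modulo `l₀` as a sum of functions regular where `l₁`, respectively `l₂`, is nonzero,
whereas `e` represents a nonzero class in `H¹` of the structure sheaf of the plane cubic `l₀ = 0`
(`not_isFrobeniusSplit_of_aeval_eq_fermat`).
-/

/-! ### Frobenius splittings of `Proj` -/

open HomogeneousLocalization in
/-- The map `a / s ↦ θ (a s) / s` on a homogeneous localization. -/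
noncomputable def HomogeneousLocalization.frobeniusSplitting {k A : Type*} [CommRing k] [CommRing A]
    [Algebra k A] {𝒜 : ℕ → Submodule k A} [GradedAlgebra 𝒜] (θ : A →+ A)
    (hθ : ∀ a b, θ (a ^ 2 * b) = a * θ b) (hdeg : ∀ n, ∀ a ∈ 𝒜 (n + n), θ a ∈ 𝒜 n)
    (M : Submonoid A) : HomogeneousLocalization 𝒜 M → HomogeneousLocalization 𝒜 M :=
  Quotient.lift
    (fun c : NumDenSameDeg 𝒜 M => .mk ⟨c.deg, ⟨θ (c.num * c.den), hdeg _ _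
      (SetLike.mul_mem_graded c.num.2 c.den.2)⟩, c.den, c.den_mem⟩)
    (by
      rintro ⟨i, ⟨a, ha⟩, ⟨s, hs⟩, hsM⟩ ⟨j, ⟨a', ha'⟩, ⟨s', hs'⟩, hsM'⟩ h
      have h : Localization.mk a ⟨s, hsM⟩ = Localization.mk a' ⟨s', hsM'⟩ := h
      rw [HomogeneousLocalization.ext_iff_val, val_mk, val_mk]
      rw [Localization.mk_eq_mk_iff, Localization.r_iff_exists] at h ⊢
      obtain ⟨⟨t, ht⟩, h⟩ := h
      refine ⟨⟨t, ht⟩, ?_⟩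
      dsimp only at h ⊢
      have h1 : θ ((t * s') ^ 2 * (a * s)) = θ ((t * s) ^ 2 * (a' * s')) := by
        congr 1; linear_combination (t * s * s') * h
      rw [hθ, hθ] at h1
      linear_combination h1)

namespace HomogeneousLocalization

variable {k A : Type*} [CommRing k] [CommRing A] [Algebra k A] {𝒜 : ℕ → Submodule k A}
  [GradedAlgebra 𝒜] (θ : A →+ A) (hθ : ∀ a b, θ (a ^ 2 * b) = a * θ b)
  (hdeg : ∀ n, ∀ a ∈ 𝒜 (n + n), θ a ∈ 𝒜 n) (M : Submonoid A)

theorem frobeniusSplitting_mk (c : NumDenSameDeg 𝒜 M) :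
    frobeniusSplitting θ hθ hdeg M (.mk c) = .mk ⟨c.deg, ⟨θ (c.num * c.den), hdeg _ _
      (SetLike.mul_mem_graded c.num.2 c.den.2)⟩, c.den, c.den_mem⟩ := rfl

theorem frobeniusSplitting_add (a b : HomogeneousLocalization 𝒜 M) :
    frobeniusSplitting θ hθ hdeg M (a + b) =
      frobeniusSplitting θ hθ hdeg M a + frobeniusSplitting θ hθ hdeg M b := by
  obtain ⟨⟨i, ⟨a, ha⟩, ⟨s, hs⟩, hsM⟩, rfl⟩ := mk_surjective a
  obtain ⟨⟨j, ⟨b, hb⟩, ⟨t, ht⟩, htM⟩, rfl⟩ := mk_surjective b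
  rw [← mk_add, frobeniusSplitting_mk, frobeniusSplitting_mk, frobeniusSplitting_mk, ← mk_add,
    HomogeneousLocalization.ext_iff_val, val_mk, val_mk]
  congr 1
  change θ ((s * b + t * a) * (s * t)) = s * θ (b * t) + t * θ (a * s)
  rw [← hθ, ← hθ, ← map_add]
  congr 1; ring

theorem frobeniusSplitting_sq_mul (a b : HomogeneousLocalization 𝒜 M) :
    frobeniusSplitting θ hθ hdeg M (a ^ 2 * b) = a * frobeniusSplitting θ hθ hdeg M b := by
  obtain ⟨⟨i, ⟨a, ha⟩, ⟨s, hs⟩, hsM⟩, rfl⟩ := mk_surjective a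
  obtain ⟨⟨j, ⟨b, hb⟩, ⟨t, ht⟩, htM⟩, rfl⟩ := mk_surjective b
  rw [← mk_pow, ← mk_mul, frobeniusSplitting_mk, frobeniusSplitting_mk, ← mk_mul,
    HomogeneousLocalization.ext_iff_val, val_mk, val_mk]
  rw [Localization.mk_eq_mk_iff, Localization.r_iff_exists]
  refine ⟨1, ?_⟩
  change 1 * (s * t * θ (a ^ 2 * b * (s ^ 2 * t))) = 1 * (s ^ 2 * t * (a * θ (b * t)))
  have : a ^ 2 * b * (s ^ 2 * t) = (a * s) ^ 2 * (b * t) := by ring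
  rw [this, hθ]
  ring

theorem frobeniusSplitting_one (h1 : θ 1 = 1) : frobeniusSplitting θ hθ hdeg M 1 = 1 := by
  rw [← mk_one, frobeniusSplitting_mk, HomogeneousLocalization.ext_iff_val, val_mk, val_mk]
  congr 1
  change θ (1 * 1) = 1
  rw [mul_one, h1]

theorem frobeniusSplitting_sq (h1 : θ 1 = 1) (a : HomogeneousLocalization 𝒜 M) :
    frobeniusSplitting θ hθ hdeg M (a ^ 2) = a := by
  have := frobeniusSplitting_sq_mul θ hθ hdeg M a 1
  rwa [frobeniusSplitting_one _ _ _ _ h1, mul_one, mul_one] at this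

end HomogeneousLocalization

namespace CubicSurface

/-- An additive self-map of the homogeneous coordinate ring that is inverse linear for the Frobenius
map, halves degrees and fixes `1` gives a Frobenius splitting of `Proj`, by applying
`a / s ↦ θ (a s) / s` to the values of the sections. -/
theorem isFrobeniusSplit_proj {k A : Type u} [CommRing k] [CommRing A] [Algebra k A]
    {𝒜 : ℕ → Submodule k A} [GradedAlgebra 𝒜] (θ : A →+ A)
    (hθ : ∀ a b, θ (a ^ 2 * b) = a * θ b) (hdeg : ∀ n, ∀ a ∈ 𝒜 (n + n), θ a ∈ 𝒜 n)
    (h1 : θ 1 = 1) : IsFrobeniusSplit 2 (Proj 𝒜) := by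
  refine ⟨fun U => AddMonoidHom.mk' (fun s => ⟨fun x =>
    HomogeneousLocalization.frobeniusSplitting θ hθ hdeg _ (s.1 x), ?_⟩) ?_, ?_, ?_, ?_⟩
  · intro x
    obtain ⟨V, hxV, i, j, ⟨r, hr⟩, ⟨t, ht⟩, hw, w⟩ := s.2 x
    refine ⟨V, hxV, i, j, ⟨θ (r * t), hdeg _ _ (SetLike.mul_mem_graded hr ht)⟩, ⟨t, ht⟩, hw,
      fun y => ?_⟩
    have := w y
    dsimp only at this ⊢
    exact (congrArg (HomogeneousLocalization.frobeniusSplitting θ hθ hdeg _) this).trans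
      (HomogeneousLocalization.frobeniusSplitting_mk θ hθ hdeg _ _)
  · intro a b
    apply Subtype.ext
    funext x
    exact HomogeneousLocalization.frobeniusSplitting_add θ hθ hdeg _ _ _
  · intro U V h a
    rfl
  · intro U a b
    apply Subtype.ext
    funext x
    exact HomogeneousLocalization.frobeniusSplitting_sq_mul θ hθ hdeg _ _ _
  · intro U a
    apply Subtype.ext
    funext x
    exact HomogeneousLocalization.frobeniusSplitting_sq θ hθ hdeg _ h1 _

end CubicSurface

/-! ### Cubic forms in characteristic two and their polarization -/

namespace CubicSurface

open MvPolynomial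

/-- The polarization of a cubic form `F` over a field of characteristic two: `D u` is the
differential of `F` at `u`, and `T` is the symmetric trilinear form of second differences. In
characteristic two `T` is alternating, so on a four-dimensional space it is contraction of a volume
form with a vector, the `pole`; this is recorded in `T_pole` and `T_ne_zero`. -/
structure CubicPolar (k V : Type*) [Field k] [AddCommGroup V] [Module k V] where
  /-- `D u v` is the derivative at `u` in the direction `v`. -/
  D : V → V →ₗ[k] k
  /-- The alternating form of second differences. -/
  T : V → V → V → k
  /-- The kernel of the alternating form `T`. -/
  pole : V
  D_add : ∀ u v w, D (u + v) w = D u w + D v w + T u v w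
  D_smul : ∀ (c : k) u w, D (c • u) w = c ^ 2 * D u w
  T_add : ∀ u u' v w, T (u + u') v w = T u v w + T u' v w
  T_smul : ∀ (c : k) u v w, T (c • u) v w = c * T u v w
  T_swap₁₂ : ∀ u v w, T u v w = T v u w
  T_swap₂₃ : ∀ u v w, T u v w = T u w v
  T_self : ∀ u w, T u u w = 0
  T_pole : ∀ u v, T pole u v = 0
  T_ne_zero : ∀ u v w, LinearIndependent k ![pole, u, v, w] → T u v w ≠ 0

variable {k : Type u} [Field k]

/-- The cubic form with coefficient `a i j` at `xᵢ² xⱼ` and coefficient `t i` at the product of the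
variables other than `xᵢ`. -/
noncomputable def cubicForm (a : Fin 4 → Fin 4 → k) (t : Fin 4 → k) : MvPolynomial (Fin 4) k :=
  (∑ i, ∑ j, C (a i j) * (X i ^ 2 * X j)) + ∑ i, C (t i) * ∏ j ∈ Finset.univ.erase i, X j

theorem cubicForm_add (a b : Fin 4 → Fin 4 → k) (t s : Fin 4 → k) :
    cubicForm (a + b) (t + s) = cubicForm a t + cubicForm b s := by
  simp only [cubicForm, Pi.add_apply, C_add, add_mul, Finset.sum_add_distrib]
  ring

theorem cubicForm_single_left (c : k) (i j : Fin 4) :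
    cubicForm (Pi.single i (Pi.single j c)) 0 = C c * (X i ^ 2 * X j) := by
  rw [cubicForm, Finset.sum_eq_single i, Finset.sum_eq_single j]
  · simp
  · intro b _ hb
    simp [Pi.single_eq_of_ne hb]
  · simp
  · intro b _ hb
    simp [Pi.single_eq_of_ne hb]
  · simp

theorem cubicForm_single_right (c : k) (i : Fin 4) :
    cubicForm 0 (Pi.single i c) = C c * ∏ j ∈ Finset.univ.erase i, X j := by
  rw [cubicForm, Finset.sum_eq_single (a := i) (s := Finset.univ) (f := fun i_1 => C _ * _)]
  · simp
  · intro b _ hb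
    simp [Pi.single_eq_of_ne hb]
  · simp

/-- A cubic monomial either has a repeated variable or is a product of three variables, the
remaining one of which determines it. -/
theorem exists_cubicForm_monomial (c : k) (i j l : Fin 4) :
    ∃ a t, C c * (X i * X j * X l) = cubicForm a t := by
  by_cases hij : i = j
  · exact ⟨_, _, by rw [cubicForm_single_left c i l, hij]; ring⟩
  by_cases hil : i = l
  · exact ⟨_, _, by rw [cubicForm_single_left c i j, hil]; ring⟩
  by_cases hjl : j = l
  · exact ⟨_, _, by rw [cubicForm_single_left c j i, hjl]; ring⟩
  obtain ⟨m, hm⟩ : ∃ m : Fin 4, Finset.univ.erase m = {i, j, l} := by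
    revert i j l; decide
  refine ⟨0, Pi.single m c, ?_⟩
  rw [cubicForm_single_right c m, hm, Finset.prod_insert (by simp [hij, hil]),
    Finset.prod_insert (by simp [hjl]), Finset.prod_singleton, mul_assoc]

theorem exists_eq_single_add {ι : Type*} [DecidableEq ι] {d : ι →₀ ℕ} {n : ℕ}
    (h : d.degree = n + 1) :
    ∃ i d', d = Finsupp.single i 1 + d' ∧ d'.degree = n := by
  have hd : d ≠ 0 := by rintro rfl; simp at h
  obtain ⟨i, hi⟩ := Finsupp.ne_iff.mp hd
  have hle : Finsupp.single i 1 ≤ d := by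
    rw [Finsupp.single_le_iff]; exact Nat.one_le_iff_ne_zero.mpr hi
  refine ⟨i, d - Finsupp.single i 1, (add_tsub_cancel_of_le hle).symm, ?_⟩
  have := congrArg Finsupp.degree (add_tsub_cancel_of_le hle)
  rw [map_add, h, Finsupp.degree_single] at this
  omega

/-- Every cubic form is a `cubicForm a t`. -/
theorem exists_cubicForm {f : MvPolynomial (Fin 4) k} (hf : f.IsHomogeneous 3) :
    ∃ a t, f = cubicForm a t := by
  have key : ∀ s : Finset (Fin 4 →₀ ℕ), s ⊆ f.support →
      ∃ a t, ∑ d ∈ s, monomial d (coeff d f) = cubicForm a t := by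
    intro s
    induction s using Finset.induction_on with
    | empty => exact fun _ => ⟨0, 0, by simp [cubicForm]⟩
    | insert d s hd ih =>
      intro hs
      obtain ⟨a, t, h⟩ := ih fun x hx => hs (Finset.mem_insert_of_mem hx)
      have hdeg : d.degree = 3 := by
        rw [Finsupp.degree_eq_weight_one]
        exact hf (mem_support_iff.mp (hs (Finset.mem_insert_self d s)))
      obtain ⟨i, d₁, rfl, hdeg₁⟩ := exists_eq_single_add hdeg
      obtain ⟨j, d₂, rfl, hdeg₂⟩ := exists_eq_single_add hdeg₁
      obtain ⟨l, d₃, rfl, hdeg₃⟩ := exists_eq_single_add hdeg₂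
      obtain rfl := (Finsupp.degree_eq_zero_iff _).mp hdeg₃
      obtain ⟨b, r, h'⟩ := exists_cubicForm_monomial
        (coeff (Finsupp.single i 1 + (Finsupp.single j 1 + (Finsupp.single l 1 + 0))) f) i j l
      refine ⟨b + a, r + t, ?_⟩
      rw [Finset.sum_insert hd, h, cubicForm_add, ← h']
      congr 1
      rw [add_zero, monomial_eq, Finsupp.prod_add_index' (by simp) (by simp [pow_add]),
        Finsupp.prod_add_index' (by simp) (by simp [pow_add])]
      simp [mul_assoc]
  obtain ⟨a, t, h⟩ := key f.support subset_rfl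
  exact ⟨a, t, by rw [← h]; exact f.as_sum⟩

/-- The differential of `cubicForm a t`, in characteristic two. -/
def cubicDifferential (a : Fin 4 → Fin 4 → k) (t u : Fin 4 → k) : (Fin 4 → k) →ₗ[k] k :=
  IsLinearMap.mk' (fun w => ∑ i, ∑ j, a i j * (u i ^ 2 * w j) +
      (t 0 * (u 1 * u 2 * w 3 + u 1 * u 3 * w 2 + u 2 * u 3 * w 1) +
      t 1 * (u 0 * u 2 * w 3 + u 0 * u 3 * w 2 + u 2 * u 3 * w 0) +
      t 2 * (u 0 * u 1 * w 3 + u 0 * u 3 * w 1 + u 1 * u 3 * w 0) +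
      t 3 * (u 0 * u 1 * w 2 + u 0 * u 2 * w 1 + u 1 * u 2 * w 0)))
    ⟨fun x y => by
        simp only [Pi.add_apply, mul_add, Finset.sum_add_distrib]
        ring,
      fun c x => by
        simp only [Pi.smul_apply, smul_eq_mul, mul_add, Finset.mul_sum]
        congr 1
        · exact Finset.sum_congr rfl fun _ _ => Finset.sum_congr rfl fun _ _ => by ring
        · ring⟩

theorem cubicDifferential_apply (a : Fin 4 → Fin 4 → k) (t u w : Fin 4 → k) :
    cubicDifferential a t u w = ∑ i, ∑ j, a i j * (u i ^ 2 * w j) +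
      (t 0 * (u 1 * u 2 * w 3 + u 1 * u 3 * w 2 + u 2 * u 3 * w 1) +
      t 1 * (u 0 * u 2 * w 3 + u 0 * u 3 * w 2 + u 2 * u 3 * w 0) +
      t 2 * (u 0 * u 1 * w 3 + u 0 * u 3 * w 1 + u 1 * u 3 * w 0) +
      t 3 * (u 0 * u 1 * w 2 + u 0 * u 2 * w 1 + u 1 * u 2 * w 0)) := rfl

theorem det_of_four (t u v w : Fin 4 → k) : Matrix.det (Matrix.of ![t, u, v, w]) =
    t 0 * (u 1 * (v 2 * w 3 - v 3 * w 2) - u 2 * (v 1 * w 3 - v 3 * w 1) +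
      u 3 * (v 1 * w 2 - v 2 * w 1)) -
    t 1 * (u 0 * (v 2 * w 3 - v 3 * w 2) - u 2 * (v 0 * w 3 - v 3 * w 0) +
      u 3 * (v 0 * w 2 - v 2 * w 0)) +
    t 2 * (u 0 * (v 1 * w 3 - v 3 * w 1) - u 1 * (v 0 * w 3 - v 3 * w 0) +
      u 3 * (v 0 * w 1 - v 1 * w 0)) -
    t 3 * (u 0 * (v 1 * w 2 - v 2 * w 1) - u 1 * (v 0 * w 2 - v 2 * w 0) +
      u 2 * (v 0 * w 1 - v 1 * w 0)) := by
  rw [Matrix.det_succ_row_zero, Fin.sum_univ_four]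
  simp [Matrix.det_fin_three, Fin.succAbove, Matrix.submatrix]
  ring

/-- The polarization of `cubicForm a t`, whose pole is `t`. -/
def cubicPolar [CharP k 2] (a : Fin 4 → Fin 4 → k) (t : Fin 4 → k) :
    CubicPolar k (Fin 4 → k) where
  D := cubicDifferential a t
  T u v w := Matrix.det (Matrix.of ![t, u, v, w])
  pole := t
  D_add u v w := by
    simp only [cubicDifferential_apply, det_of_four, Fin.sum_univ_four, Pi.add_apply, Fin.isValue]
    rw [← sub_eq_zero]
    ring_nf
    reduce_mod_char!
  D_smul c u w := by
    simp only [cubicDifferential_apply, Fin.sum_univ_four, Pi.smul_apply, smul_eq_mul]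
    ring
  T_add u u' v w := by
    simp only [det_of_four, Pi.add_apply]
    ring
  T_smul c u v w := by
    simp only [det_of_four, Pi.smul_apply, smul_eq_mul]
    ring
  T_swap₁₂ u v w := by
    rw [← CharTwo.neg_eq (Matrix.det _)]
    simp only [det_of_four]
    ring
  T_swap₂₃ u v w := by
    rw [← CharTwo.neg_eq (Matrix.det _)]
    simp only [det_of_four]
    ring
  T_self u w := by
    simp only [det_of_four]
    ring
  T_pole u v := by
    simp only [det_of_four]
    ring
  T_ne_zero u v w h := by
    have : IsUnit (Matrix.of ![t, u, v, w]) := Matrix.linearIndependent_rows_iff_isUnit.mp h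
    exact ((Matrix.isUnit_iff_isUnit_det _).mp this).ne_zero

theorem eval_cubicForm [CharP k 2] (a : Fin 4 → Fin 4 → k) (t u : Fin 4 → k) :
    eval u (cubicForm a t) = (cubicPolar a t).D u u := by
  have h0 : (Finset.univ.erase 0 : Finset (Fin 4)) = {1, 2, 3} := by decide
  have h1 : (Finset.univ.erase 1 : Finset (Fin 4)) = {0, 2, 3} := by decide
  have h2 : (Finset.univ.erase 2 : Finset (Fin 4)) = {0, 1, 3} := by decide
  have h3 : (Finset.univ.erase 3 : Finset (Fin 4)) = {0, 1, 2} := by decide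
  have two : (2 : k) = 0 := CharTwo.two_eq_zero
  change _ = cubicDifferential a t u u
  rw [cubicDifferential_apply, cubicForm, map_add, map_sum, map_sum]
  congr 1
  · simp
  · simp [Fin.sum_univ_four, h0, h1, h2, h3]
    linear_combination (-t 0 * u 1 * u 2 * u 3 - t 1 * u 0 * u 2 * u 3 - t 2 * u 0 * u 1 * u 3
      - t 3 * u 0 * u 1 * u 2) * two

theorem eval_pderiv_cubicForm [CharP k 2] (a : Fin 4 → Fin 4 → k) (t u : Fin 4 → k) (i : Fin 4) :
    eval u (pderiv i (cubicForm a t)) = (cubicPolar a t).D u (Pi.single i 1) := by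
  have h0 : (Finset.univ.erase 0 : Finset (Fin 4)) = {1, 2, 3} := by decide
  have h1 : (Finset.univ.erase 1 : Finset (Fin 4)) = {0, 2, 3} := by decide
  have h2 : (Finset.univ.erase 2 : Finset (Fin 4)) = {0, 1, 3} := by decide
  have h3 : (Finset.univ.erase 3 : Finset (Fin 4)) = {0, 1, 2} := by decide
  have two : (2 : MvPolynomial (Fin 4) k) = 0 := CharTwo.two_eq_zero
  change _ = cubicDifferential a t u _
  rw [cubicDifferential_apply, cubicForm, map_add, map_add, map_sum, map_sum]
  congr 1
  · simp [pderiv_X, two, Pi.single_apply, apply_ite]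
  · fin_cases i <;> simp [Fin.sum_univ_four, h0, h1, h2, h3, pderiv_X]

theorem IsSmooth.exists_D_ne_zero [CharP k 2] {a : Fin 4 → Fin 4 → k} {t : Fin 4 → k}
    (h : IsSmooth (cubicForm a t)) (u : Fin 4 → k) (hu : u ≠ 0) :
    ∃ w, (cubicPolar a t).D u w ≠ 0 := by
  by_contra! H
  obtain ⟨i, hi⟩ := h u hu (by rw [eval_cubicForm, H])
  exact hi (by rw [eval_pderiv_cubicForm, H])

theorem isLineOn_span_pair [CharP k 2] {a : Fin 4 → Fin 4 → k} {t u v : Fin 4 → k}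
    (huv : LinearIndependent k ![u, v]) (huu : (cubicPolar a t).D u u = 0)
    (hvv : (cubicPolar a t).D v v = 0) (h1 : (cubicPolar a t).D u v = 0)
    (h2 : (cubicPolar a t).D v u = 0) : IsLineOn (cubicForm a t) (Submodule.span k {u, v}) := by
  refine ⟨?_, fun w hw => ?_⟩
  · have := finrank_span_eq_card huv
    have hr : Set.range ![u, v] = {u, v} := by
      ext x; simp [eq_comm, or_comm]
    rwa [hr, Fintype.card_fin] at this
  · obtain ⟨x, y, rfl⟩ := Submodule.mem_span_pair.mp hw
    have hs : ∀ w, (cubicPolar a t).T (x • u) (y • v) w = x * y * (cubicPolar a t).T u v w := by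
      intro w
      rw [CubicPolar.T_smul, CubicPolar.T_swap₁₂, CubicPolar.T_smul, CubicPolar.T_swap₁₂]
      ring
    rw [eval_cubicForm, CubicPolar.D_add, CubicPolar.D_smul, CubicPolar.D_smul, hs]
    have hTw : (cubicPolar a t).T u v (x • u + y • v) = 0 := by
      rw [CubicPolar.T_swap₂₃, CubicPolar.T_swap₁₂, CubicPolar.T_add, CubicPolar.T_smul,
        CubicPolar.T_smul, CubicPolar.T_self, CubicPolar.T_swap₂₃, CubicPolar.T_swap₁₂,
        CubicPolar.T_self]
      ring
    simp [hTw, huu, hvv, h1, h2]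

end CubicSurface

/-! ### The trace of the polynomial ring, and splitting for a nonzero pole -/

namespace CubicSurface

open MvPolynomial

variable {k : Type u} [Field k]

section Trace

/-- The mixed derivative `∂₀ ∂₁ ∂₂ ∂₃`. -/
noncomputable def mixedDeriv : MvPolynomial (Fin 4) k →+ MvPolynomial (Fin 4) k :=
  (((pderiv 0).toLinearMap ∘ₗ (pderiv 1).toLinearMap ∘ₗ (pderiv 2).toLinearMap ∘ₗ
    (pderiv 3).toLinearMap : MvPolynomial (Fin 4) k →ₗ[k] MvPolynomial (Fin 4) k)).toAddMonoidHom

theorem mixedDeriv_apply (g : MvPolynomial (Fin 4) k) :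
    mixedDeriv g = pderiv 0 (pderiv 1 (pderiv 2 (pderiv 3 g))) := rfl

theorem pderiv_sq_mul [CharP k 2] (i : Fin 4) (a b : MvPolynomial (Fin 4) k) :
    pderiv i (a ^ 2 * b) = a ^ 2 * pderiv i b := by
  have two : (2 : MvPolynomial (Fin 4) k) = 0 := CharTwo.two_eq_zero
  rw [pderiv_mul, pderiv_pow]
  simp [two]

theorem mixedDeriv_sq_mul [CharP k 2] (a b : MvPolynomial (Fin 4) k) :
    mixedDeriv (a ^ 2 * b) = a ^ 2 * mixedDeriv b := by
  simp only [mixedDeriv_apply, pderiv_sq_mul]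

theorem mixedDeriv_cubicForm_mul_X [CharP k 2] (a : Fin 4 → Fin 4 → k) (t : Fin 4 → k)
    (i : Fin 4) :
    mixedDeriv (cubicForm a t * X i) = C (t i) := by
  have h0 : (Finset.univ.erase 0 : Finset (Fin 4)) = {1, 2, 3} := by decide
  have h1 : (Finset.univ.erase 1 : Finset (Fin 4)) = {0, 2, 3} := by decide
  have h2 : (Finset.univ.erase 2 : Finset (Fin 4)) = {0, 1, 3} := by decide
  have h3 : (Finset.univ.erase 3 : Finset (Fin 4)) = {0, 1, 2} := by decide
  rw [cubicForm, add_mul, map_add, Finset.sum_mul, map_sum, Finset.sum_mul, map_sum]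
  have e1 : ∀ j, mixedDeriv ((∑ l, C (a j l) * (X j ^ 2 * X l)) * X i) = 0 := by
    intro j
    rw [Finset.sum_mul, map_sum]
    refine Finset.sum_eq_zero fun l _ => ?_
    have : C (a j l) * (X j ^ 2 * X l) * X i =
      X j ^ 2 * (C (a j l) * X l * X i : MvPolynomial (Fin 4) k) := by ring
    rw [this, mixedDeriv_sq_mul, mixedDeriv_apply]
    fin_cases i <;> fin_cases l <;> simp [pderiv_X]
  simp only [e1, Finset.sum_const_zero, zero_add]
  fin_cases i <;> simp [Fin.sum_univ_four, h0, h1, h2, h3, pderiv_X, mixedDeriv_apply]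

theorem isHomogeneous_of_sq [CharP k 2] {h : MvPolynomial (Fin 4) k} {n : ℕ}
    (hh : (h ^ 2).IsHomogeneous (n + n)) : h.IsHomogeneous n := by
  intro d hd
  have h1 : coeff (d + d) (h ^ 2) ≠ 0 := by
    have e : h ^ 2 = expand 2 (map (frobenius k 2) h) := by
      rw [← map_frobenius_expand, map_expand]
    rw [e, ← two_nsmul, coeff_expand_smul _ two_ne_zero, coeff_map]
    simpa [frobenius_def] using hd
  have h2 := hh h1
  rw [map_add] at h2
  omega

variable [IsAlgClosed k] [CharP k 2]

/-- The mixed derivative kills a monomial with an even exponent and makes all exponents of the other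
monomials even. -/
theorem exists_sq_eq_mixedDeriv (g : MvPolynomial (Fin 4) k) :
    ∃ h : MvPolynomial (Fin 4) k, h ^ 2 = mixedDeriv g := by
  induction g using MvPolynomial.induction_on' with
  | add p q hp hq =>
    obtain ⟨a, ha⟩ := hp
    obtain ⟨b, hb⟩ := hq
    exact ⟨a + b, by rw [CharTwo.add_sq, ha, hb, map_add]⟩
  | monomial m c =>
    by_cases hm : ∀ i, Odd (m i)
    · choose n hn using hm
      obtain ⟨b, hb⟩ := IsAlgClosed.exists_pow_nat_eq c (n := 2) (by norm_num)
      refine ⟨monomial (Finsupp.equivFunOnFinite.symm n) b, ?_⟩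
      rw [mixedDeriv_apply, monomial_pow, hb]
      simp only [pderiv_monomial]
      have two : (2 : k) = 0 := CharTwo.two_eq_zero
      congr 1
      · congr 1
        ext i
        fin_cases i <;> simp [hn]
      · simp [hn, two]
    · obtain ⟨i, hi⟩ := not_forall.mp hm
      obtain ⟨r, hr⟩ := Nat.not_odd_iff_even.mp hi
      have hc : (m i : k) = 0 := by rw [hr, Nat.cast_add, CharTwo.add_self_eq_zero]
      refine ⟨0, ?_⟩
      rw [mixedDeriv_apply]
      simp only [pderiv_monomial]
      rw [zero_pow two_ne_zero, eq_comm, monomial_eq_zero]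
      fin_cases i <;> simp_all

/-- The generator of the dual of the Frobenius push-forward of the polynomial ring: the inverse
Frobenius applied to the mixed derivative. It takes `c² x₀^(2a+1) ⋯ x₃^(2d+1)` to
`c x₀^a ⋯ x₃^d`, and all other monomials to zero. -/
noncomputable def frobTrace : MvPolynomial (Fin 4) k →+ MvPolynomial (Fin 4) k :=
  AddMonoidHom.mk' (fun g => (exists_sq_eq_mixedDeriv g).choose) fun a b => by
    apply CharTwo.sq_injective
    beta_reduce
    rw [CharTwo.add_sq, (exists_sq_eq_mixedDeriv _).choose_spec,
      (exists_sq_eq_mixedDeriv _).choose_spec, (exists_sq_eq_mixedDeriv _).choose_spec, map_add]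

theorem frobTrace_sq (g : MvPolynomial (Fin 4) k) : frobTrace g ^ 2 = mixedDeriv g :=
  (exists_sq_eq_mixedDeriv g).choose_spec

theorem frobTrace_sq_mul (a b : MvPolynomial (Fin 4) k) :
    frobTrace (a ^ 2 * b) = a * frobTrace b := by
  apply CharTwo.sq_injective
  beta_reduce
  rw [frobTrace_sq, mixedDeriv_sq_mul, mul_pow, frobTrace_sq]

theorem frobTrace_isHomogeneous {g : MvPolynomial (Fin 4) k} {n : ℕ}
    (hg : g.IsHomogeneous (n + n + 4)) : (frobTrace g).IsHomogeneous n := by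
  apply isHomogeneous_of_sq
  rw [frobTrace_sq, mixedDeriv_apply]
  exact (((hg.pderiv (i := 3)).pderiv (i := 2)).pderiv (i := 1)).pderiv (i := 0)

/-- If the coefficient `tᵢ` is nonzero, then `g ↦ frobTrace (tᵢ⁻¹ f xᵢ g)` preserves the ideal of
`f` and takes `1` to `1`, since `∂₀∂₁∂₂∂₃ (f xᵢ) = tᵢ`. -/
theorem isFrobeniusSplit_cubicForm (a : Fin 4 → Fin 4 → k) {t : Fin 4 → k} (ht : t ≠ 0)
    (hf : (cubicForm a t).IsHomogeneous 3) :
    IsFrobeniusSplit 2 (surface (cubicForm a t) hf) := by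
  obtain ⟨i, hi⟩ := Function.ne_iff.mp ht
  have hi : t i ≠ 0 := hi
  set f := cubicForm a t with hfdef
  let π : MvPolynomial (Fin 4) k →+ MvPolynomial (Fin 4) k ⧸ Ideal.span {f} :=
    (Ideal.Quotient.mkₐ k (Ideal.span {f}) : _ →+* _).toAddMonoidHom
  have hπ : Function.Surjective π := Ideal.Quotient.mkₐ_surjective k _
  have hπm : ∀ x y, π (x * y) = π x * π y := map_mul (Ideal.Quotient.mkₐ k (Ideal.span {f}))
  have hπp : ∀ x, π (x ^ 2) = π x ^ 2 := fun x =>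
    map_pow (Ideal.Quotient.mkₐ k (Ideal.span {f})) x 2
  let θ₀ : MvPolynomial (Fin 4) k →+ MvPolynomial (Fin 4) k :=
    frobTrace.comp (AddMonoidHom.mulLeft (C (t i)⁻¹ * (f * X i)))
  have hθ₀ : ∀ g, θ₀ g = frobTrace (C (t i)⁻¹ * (f * X i) * g) := fun _ => rfl
  have hθ₀m : ∀ x y, θ₀ (x ^ 2 * y) = x * θ₀ y := by
    intro x y
    rw [hθ₀, hθ₀, ← frobTrace_sq_mul]
    congr 1; ring
  have hker : π.ker ≤ (π.comp θ₀).ker := by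
    intro g hg
    obtain ⟨h, rfl⟩ := Ideal.mem_span_singleton'.mp (Ideal.Quotient.eq_zero_iff_mem.mp hg)
    have e : C (t i)⁻¹ * (f * X i) * (h * f) = f ^ 2 * (C (t i)⁻¹ * X i * h) := by ring
    rw [AddMonoidHom.mem_ker, AddMonoidHom.comp_apply, hθ₀, e, frobTrace_sq_mul, hπm]
    have : π f = 0 := Ideal.Quotient.eq_zero_iff_mem.mpr (Ideal.mem_span_singleton_self f)
    rw [this, zero_mul]
  let θ := π.liftOfSurjective hπ ⟨π.comp θ₀, hker⟩
  have hθ : ∀ g, θ (π g) = π (θ₀ g) := fun g =>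
    AddMonoidHom.liftOfRightInverse_comp_apply _ _ _ _ _
  let := coordGradedAlgebra f hf
  refine isFrobeniusSplit_proj (𝒜 := coordGrading f) θ ?_ ?_ ?_
  · intro x y
    obtain ⟨x, rfl⟩ := hπ x
    obtain ⟨y, rfl⟩ := hπ y
    rw [← hπp, ← hπm, hθ, hθ, hθ₀m, hπm]
  · rintro n _ ⟨g, hg, rfl⟩
    refine ⟨θ₀ g, ?_, (hθ g).symm⟩
    refine frobTrace_isHomogeneous ?_
    have h := ((isHomogeneous_C (Fin 4) (t i)⁻¹).mul
      (hf.mul (isHomogeneous_X k i))).mul (show g.IsHomogeneous (n + n) from hg)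
    rw [show n + n + 4 = 0 + (3 + 1) + (n + n) by omega]
    exact h
  · have h1 : θ₀ 1 = 1 := by
      apply CharTwo.sq_injective
      beta_reduce
      obtain ⟨b, hb⟩ := IsAlgClosed.exists_pow_nat_eq (t i)⁻¹ (n := 2) (by norm_num)
      rw [hθ₀, frobTrace_sq, mul_one, ← hb, C_pow, mixedDeriv_sq_mul, hfdef,
        mixedDeriv_cubicForm_mul_X, ← C_pow, hb, ← C_mul, inv_mul_cancel₀ hi]
      simp
    have hone : π 1 = 1 := map_one (Ideal.Quotient.mkₐ k (Ideal.span {f}))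
    rw [← hone, hθ, h1]

end Trace

end CubicSurface

/-! ### Vectors and lines with respect to the polarization -/

namespace CubicSurface

open Polynomial in
theorem exists_eval_eq_zero_of_coeff_ne_zero {k : Type*} [Field k] [IsAlgClosed k] {P : k[X]}
    {n : ℕ} (hn : 0 < n) (h : P.coeff n ≠ 0) : ∃ y, P.eval y = 0 := by
  refine IsAlgClosed.exists_root P fun h0 => h ?_
  exact coeff_eq_zero_of_degree_lt (by rw [h0]; exact_mod_cast hn)

open Polynomial in
/-- A nonconstant polynomial of degree at most five has a root; the coefficients are listed so that
lower degrees are covered too. -/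
theorem exists_quintic_root {k : Type*} [Field k] [IsAlgClosed k] (c₀ c₁ c₂ c₃ c₄ c₅ : k)
    (h : ¬ (c₁ = 0 ∧ c₂ = 0 ∧ c₃ = 0 ∧ c₄ = 0 ∧ c₅ = 0)) :
    ∃ y, c₀ + c₁ * y + c₂ * y ^ 2 + c₃ * y ^ 3 + c₄ * y ^ 4 + c₅ * y ^ 5 = 0 := by
  let P : k[X] := C c₀ + C c₁ * X + C c₂ * X ^ 2 + C c₃ * X ^ 3 + C c₄ * X ^ 4 + C c₅ * X ^ 5
  obtain ⟨n, hn, hc⟩ : ∃ n, 0 < n ∧ P.coeff n ≠ 0 := by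
    contrapose! h
    have h1 := h 1 (by norm_num)
    have h2 := h 2 (by norm_num)
    have h3 := h 3 (by norm_num)
    have h4 := h 4 (by norm_num)
    have h5 := h 5 (by norm_num)
    simp [P, coeff_C, coeff_X_pow] at h1 h2 h3 h4 h5
    exact ⟨h1, h2, h3, h4, h5⟩
  obtain ⟨y, hy⟩ := exists_eval_eq_zero_of_coeff_ne_zero hn hc
  exact ⟨y, by simpa [P] using hy⟩

namespace CubicPolar

variable {k V : Type*} [Field k] [AddCommGroup V] [Module k V] (Q : CubicPolar k V)

theorem T_add_mid (u v v' w : V) : Q.T u (v + v') w = Q.T u v w + Q.T u v' w := by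
  rw [Q.T_swap₁₂, Q.T_add, Q.T_swap₁₂ v, Q.T_swap₁₂ v']

theorem T_smul_mid (c : k) (u v w : V) : Q.T u (c • v) w = c * Q.T u v w := by
  rw [Q.T_swap₁₂, Q.T_smul, Q.T_swap₁₂ v]

theorem T_add_right (u v w w' : V) : Q.T u v (w + w') = Q.T u v w + Q.T u v w' := by
  rw [Q.T_swap₂₃, Q.T_add_mid, Q.T_swap₂₃ u w, Q.T_swap₂₃ u w']

theorem T_smul_right (c : k) (u v w : V) : Q.T u v (c • w) = c * Q.T u v w := by
  rw [Q.T_swap₂₃, Q.T_smul_mid, Q.T_swap₂₃ u w]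

theorem T_self₂₃ (u v : V) : Q.T u v v = 0 := by
  rw [Q.T_swap₁₂, Q.T_swap₂₃, Q.T_self]

theorem T_self₁₃ (u v : V) : Q.T u v u = 0 := by
  rw [Q.T_swap₂₃, Q.T_self]

theorem T_pole_mid (u v : V) : Q.T u Q.pole v = 0 := by
  rw [Q.T_swap₁₂, Q.T_pole]

theorem T_pole_right (u v : V) : Q.T u v Q.pole = 0 := by
  rw [Q.T_swap₂₃, Q.T_pole_mid]

attribute [simp] D_add D_smul T_add T_smul T_self T_pole T_add_mid T_smul_mid T_add_right
  T_smul_right T_self₂₃ T_self₁₃ T_pole_mid T_pole_right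

/-- The line spanned by `u` and `v` lies on the cubic surface. -/
def Isotropic (u v : V) : Prop := Q.D u u = 0 ∧ Q.D v v = 0 ∧ Q.D u v = 0 ∧ Q.D v u = 0

/-- The differential vanishes at no nonzero vector. -/
def Smooth : Prop := ∀ u, u ≠ 0 → ∃ w, Q.D u w ≠ 0

variable {Q}

theorem Isotropic.D_comb {u v : V} (h : Q.Isotropic u v) (a b c d : k) :
    Q.D (a • u + b • v) (c • u + d • v) = 0 := by
  obtain ⟨h1, h2, h3, h4⟩ := h
  simp [h1, h2, h3, h4]

theorem Isotropic.comb {u v : V} (h : Q.Isotropic u v) (a b c d : k) :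
    Q.Isotropic (a • u + b • v) (c • u + d • v) :=
  ⟨h.D_comb _ _ _ _, h.D_comb _ _ _ _, h.D_comb _ _ _ _, h.D_comb _ _ _ _⟩

theorem linearIndependent_of_T {u v w : V} (h : Q.T u v w ≠ 0) :
    LinearIndependent k ![u, v, w] := by
  rw [Fintype.linearIndependent_iff]
  intro g hg
  simp only [Fin.sum_univ_three, Matrix.cons_val] at hg
  have key : ∀ x y, Q.T (g 0 • u + g 1 • v + g 2 • w) x y = 0 := by
    intro x y
    rw [hg]
    have := Q.T_smul 0 0 x y
    rwa [zero_smul, zero_mul] at this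
  have h0 := key v w
  have h1 := key u w
  have h2 := key u v
  simp only [Q.T_add, Q.T_smul, Q.T_self, Q.T_self₁₃, mul_zero, add_zero,
    zero_add] at h0 h1 h2
  rw [Q.T_swap₁₂ v u w] at h1
  rw [Q.T_swap₁₂ w u v, Q.T_swap₂₃ u w v] at h2
  simp only [mul_eq_zero, h, or_false] at h0 h1 h2
  intro i
  fin_cases i <;> assumption

theorem linearIndependent_pair_of_T {u v w : V} (h : Q.T u v w ≠ 0) :
    LinearIndependent k ![u, v] := by
  have := (linearIndependent_of_T h).comp ![0, 1] (by decide)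
  convert this using 1
  ext i; fin_cases i <;> rfl

theorem linearIndependent_pole_of_T (hp : Q.pole ≠ 0) {u v w : V} (h : Q.T u v w ≠ 0) :
    LinearIndependent k ![Q.pole, u, v, w] := by
  refine linearIndependent_finCons.mpr ⟨linearIndependent_of_T h, fun hsp => ?_⟩
  obtain ⟨g, hg⟩ := (Submodule.mem_span_range_iff_exists_fun k).mp hsp
  simp only [Fin.sum_univ_three, Matrix.cons_val] at hg
  have key : ∀ x y, Q.T (g 0 • u + g 1 • v + g 2 • w) x y = 0 := by
    intro x y
    rw [hg, Q.T_pole]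
  have h0 := key v w
  have h1 := key u w
  have h2 := key u v
  simp only [Q.T_add, Q.T_smul, Q.T_self, Q.T_self₁₃, mul_zero, add_zero,
    zero_add] at h0 h1 h2
  rw [Q.T_swap₁₂ v u w] at h1
  rw [Q.T_swap₁₂ w u v, Q.T_swap₂₃ u w v] at h2
  simp only [mul_eq_zero, h, or_false] at h0 h1 h2
  apply hp
  rw [← hg, h0, h1, h2]
  simp

theorem linearIndependent_pole_pair_of_T (hp : Q.pole ≠ 0) {u v w : V} (h : Q.T u v w ≠ 0) :
    LinearIndependent k ![Q.pole, u, v] := by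
  have := (linearIndependent_pole_of_T hp h).comp ![0, 1, 2] (by decide)
  convert this using 1
  ext i; fin_cases i <;> rfl

theorem exists_T_eq_one (hV : Module.finrank k V = 4) {u v : V}
    (h : LinearIndependent k ![Q.pole, u, v]) : ∃ w, Q.T u v w = 1 := by
  obtain ⟨w, hw⟩ : ∃ w, w ∉ Submodule.span k (Set.range ![Q.pole, u, v]) := by
    by_contra! H
    have h1 := finrank_span_eq_card h
    rw [(Submodule.eq_top_iff').mpr H, finrank_top, hV] at h1
    simp at h1
  have h4 : LinearIndependent k ![w, Q.pole, u, v] := linearIndependent_finCons.mpr ⟨h, hw⟩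
  have h5 := h4.comp ![1, 2, 3, 0] (by decide)
  have h6 : LinearIndependent k ![Q.pole, u, v, w] := by
    convert h5 using 1
    ext i; fin_cases i <;> rfl
  refine ⟨(Q.T u v w)⁻¹ • w, ?_⟩
  rw [Q.T_smul_right, inv_mul_cancel₀ (Q.T_ne_zero _ _ _ h6)]

/-- The differential at a nonzero vector cannot vanish on the whole basis `pole, u, v, w`. -/
theorem Smooth.ne_zero_of_T (hs : Q.Smooth) (hV : Module.finrank k V = 4) (hp : Q.pole ≠ 0)
    {u v w : V} (h : Q.T u v w ≠ 0) {x : V} (hx : x ≠ 0) (h1 : Q.D x Q.pole = 0)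
    (h2 : Q.D x u = 0) (h3 : Q.D x v = 0) : Q.D x w ≠ 0 := by
  intro h4
  obtain ⟨y, hy⟩ := hs x hx
  have hli := linearIndependent_pole_of_T hp h
  have hsp := hli.span_eq_top_of_card_eq_finrank (by simp [hV])
  have hle : Submodule.span k (Set.range ![Q.pole, u, v, w]) ≤ LinearMap.ker (Q.D x) := by
    rw [Submodule.span_le]
    rintro _ ⟨i, rfl⟩
    fin_cases i <;> simpa
  rw [hsp] at hle
  exact hy (hle (Submodule.mem_top (x := y)))

end CubicPolar

end CubicSurface

/-! ### From a line to a triangle -/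

namespace CubicSurface
namespace CubicPolar

variable {k V : Type*} [Field k] [AddCommGroup V] [Module k V] {Q : CubicPolar k V}

/-- A line of a smooth cubic surface that avoids the pole is a side of a triangle of lines: some
plane through the line meets the surface in a conic that is singular at a point `q` off the line, so that
the conic consists of two lines through `q`. -/
theorem Smooth.exists_triangle [IsAlgClosed k] [CharP k 2] (hs : Q.Smooth)
    (hV : Module.finrank k V = 4) (hp : Q.pole ≠ 0) {u v : V}
    (huv : LinearIndependent k ![Q.pole, u, v]) (hiso : Q.Isotropic u v) :
    ∃ u₁ u₂ q, LinearIndependent k ![u₁, u₂, q] ∧ Q.Isotropic u₁ u₂ ∧ Q.Isotropic u₁ q ∧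
      Q.Isotropic u₂ q := by
  have two : (2 : k) = 0 := CharTwo.two_eq_zero
  obtain ⟨x, hx⟩ := exists_T_eq_one hV huv
  -- a basis `z, w` of the line with `w` in the polar of the pole
  obtain ⟨z, w, hzw, hT, hwp⟩ : ∃ z w, Q.Isotropic z w ∧ Q.T z w x = 1 ∧ Q.D w Q.pole = 0 := by
    by_cases h : Q.D v Q.pole = 0
    · exact ⟨u, v, hiso, hx, h⟩
    · obtain ⟨t, ht⟩ := IsAlgClosed.exists_pow_nat_eq (Q.D u Q.pole / Q.D v Q.pole) (n := 2)
        (by norm_num)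
      refine ⟨v, u + t • v, ?_, ?_, ?_⟩
      · simpa using hiso.comb 0 1 1 t
      · simp
        rw [Q.T_swap₁₂, hx]
      · simp
        rw [ht, div_mul_cancel₀ _ h]
        exact CharTwo.add_self_eq_zero _
  have hne : ∀ {a b : V}, Q.T a b x = 1 → a ≠ 0 ∧ b ≠ 0 := by
    intro a b h
    constructor <;> rintro rfl
    · have := Q.T_smul 0 0 b x
      simp_all
    · have := Q.T_smul_mid 0 a 0 x
      simp_all
  have hc : Q.D w x ≠ 0 :=
    hs.ne_zero_of_T hV hp (by rw [hT]; exact one_ne_zero) (hne hT).2 hwp hzw.2.2.2 hzw.2.1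
  obtain ⟨α, hα⟩ := exists_quintic_root (Q.D z x) 1 (Q.D w x) 0 0 0 (by simp)
  obtain ⟨z, hzw, hT, hzx⟩ : ∃ z, Q.Isotropic z w ∧ Q.T z w x = 1 ∧ Q.D z x = 0 := by
    refine ⟨z + α • w, ?_, ?_, ?_⟩
    · simpa using hzw.comb 1 α 0 1
    · simp [hT]
    · simp [hT]
      linear_combination hα
  clear hα α
  obtain ⟨hzz, hww, hzw', hwz⟩ := hzw
  have hκ : Q.D z Q.pole ≠ 0 := by
    intro h
    exact hs.ne_zero_of_T hV hp (by rw [hT]; exact one_ne_zero) (hne hT).1 h hzz hzw' hzx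
  -- For every `y` there is a unique `q` in `x + y • pole + ⟨z, w⟩` whose differential vanishes on
  -- the line; the condition that `q` lies on the surface is a quintic equation in `y`.
  obtain ⟨y, hy⟩ := exists_quintic_root
    (Q.D x x + (Q.D x z) ^ 2 * Q.D w x + Q.D x z * Q.D x w)
    (Q.D x Q.pole + Q.D x w ^ 2 * Q.D z Q.pole)
    (Q.D Q.pole x + Q.D x z * Q.D Q.pole w + Q.D Q.pole z * Q.D x w)
    (Q.D Q.pole Q.pole)
    (Q.D Q.pole z ^ 2 * Q.D w x + Q.D Q.pole z * Q.D Q.pole w)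
    (Q.D Q.pole w ^ 2 * Q.D z Q.pole) (by
      rintro ⟨-, h2, h3, h4, h5⟩
      have hw : Q.D Q.pole w = 0 := by simpa [hκ] using h5
      have hz : Q.D Q.pole z = 0 := by simpa [hw, hc] using h4
      have hx : Q.D Q.pole x = 0 := by simpa [hw, hz] using h2
      exact hs.ne_zero_of_T hV hp (by rw [hT]; exact one_ne_zero) hp h3 hz hw hx)
  -- the singular point of the plane section away from the line
  obtain ⟨q, hqz, hqw, hqq, hTq⟩ : ∃ q, Q.D q z = 0 ∧ Q.D q w = 0 ∧ Q.D q q = 0 ∧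
      Q.T z w q = 1 := by
    have hTzx : Q.T z x w = 1 := by rw [Q.T_swap₂₃, hT]
    have hTxz : Q.T x z w = 1 := by rw [Q.T_swap₁₂, hTzx]
    have hTwx : Q.T x w z = 1 := by rw [Q.T_swap₂₃, hTxz]
    refine ⟨x + y • Q.pole + (Q.D x w + y ^ 2 * Q.D Q.pole w) • z +
      (Q.D x z + y ^ 2 * Q.D Q.pole z) • w, ?_, ?_, ?_, ?_⟩
    · simp [hzz, hwz, hTwx]
      linear_combination (Q.D x z + y ^ 2 * Q.D Q.pole z) * two
    · simp [hzw', hww, hTxz]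
      linear_combination (Q.D x w + y ^ 2 * Q.D Q.pole w) * two
    · simp [hzw', hww, hzz, hwz, hTxz, hwp, hzx]
      linear_combination hy +
        ((Q.D x w + y ^ 2 * Q.D Q.pole w) * (Q.D x z + y ^ 2 * Q.D Q.pole z) +
          y ^ 2 * Q.D x z * Q.D Q.pole z * Q.D w x +
          y ^ 3 * Q.D x w * Q.D Q.pole w * Q.D z Q.pole) * two
    · simp [hT]
  -- the two isotropic directions of the conic on the line
  obtain ⟨u₁, u₂, h12, h1, h2, h1', h2', hT'⟩ : ∃ u₁ u₂, Q.Isotropic u₁ u₂ ∧ Q.D u₁ q = 0 ∧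
      Q.D u₂ q = 0 ∧ Q.D q u₁ = 0 ∧ Q.D q u₂ = 0 ∧ Q.T u₁ u₂ q ≠ 0 := by
    have hiso : Q.Isotropic z w := ⟨hzz, hww, hzw', hwz⟩
    by_cases hA : Q.D z q = 0
    · refine ⟨z, Q.D w q • z + w, by simpa using hiso.comb 1 0 (Q.D w q) 1, hA, ?_, hqz,
        by simp [hqz, hqw], ?_⟩
      · simp [hA, hTq, CharTwo.add_self_eq_zero]
      · simp [hTq]
    · obtain ⟨s, hs⟩ := exists_quintic_root (Q.D w q) 1 (Q.D z q) 0 0 0 (by simp)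
      have hTq' : Q.T w z q = 1 := by rw [Q.T_swap₁₂, hTq]
      refine ⟨s • z + w, (s + (Q.D z q)⁻¹) • z + w,
        by simpa using hiso.comb s 1 (s + (Q.D z q)⁻¹) 1, ?_, ?_,
        by simp [hqz, hqw], by simp [hqz, hqw], ?_⟩
      · simp [hTq]
        linear_combination hs
      · simp [hTq]
        field_simp
        linear_combination (Q.D z q) * hs + (s * Q.D z q + 1) * two
      · simp [hTq, hTq']
        intro h
        apply hA
        have : (Q.D z q)⁻¹ = 0 := by linear_combination h - s * two
        simpa using this
  exact ⟨u₁, u₂, q, linearIndependent_of_T hT', h12, ⟨h12.1, hqq, h1, h1'⟩,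
    ⟨h12.2.1, hqq, h2, h2'⟩⟩

theorem T_zero_left (Q : CubicPolar k V) (v w : V) : Q.T 0 v w = 0 := by
  have := Q.T_smul 0 0 v w
  rwa [zero_smul, zero_mul] at this

theorem ne_zero_of_T {u v w : V} (h : Q.T u v w ≠ 0) : u ≠ 0 := by
  rintro rfl
  exact h (Q.T_zero_left v w)

/-- If a smooth cubic surface contains a line through the pole, it contains a line that avoids the
pole: the other lines in the degenerate plane sections through the given line cannot all pass
through the pole. -/
theorem Smooth.exists_line_avoiding_pole [IsAlgClosed k] [CharP k 2] (hs : Q.Smooth)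
    (hV : Module.finrank k V = 4) (hp : Q.pole ≠ 0) {z : V}
    (hz : LinearIndependent k ![Q.pole, z]) (hiso : Q.Isotropic Q.pole z) :
    ∃ u v, LinearIndependent k ![Q.pole, u, v] ∧ Q.Isotropic u v := by
  have two : (2 : k) = 0 := CharTwo.two_eq_zero
  obtain ⟨x, hx⟩ : ∃ x, Q.D Q.pole x = 1 := by
    obtain ⟨x, hx⟩ := hs Q.pole hp
    exact ⟨(Q.D Q.pole x)⁻¹ • x, by simp [hx]⟩
  have hzx : LinearIndependent k ![Q.pole, z, x] := by
    have h3 : LinearIndependent k ![x, Q.pole, z] := by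
      refine linearIndependent_finCons.mpr ⟨hz, fun hsp => ?_⟩
      have hle : Submodule.span k (Set.range ![Q.pole, z]) ≤ LinearMap.ker (Q.D Q.pole) := by
        rw [Submodule.span_le]
        rintro _ ⟨i, rfl⟩
        fin_cases i
        · simpa using hiso.1
        · simpa using hiso.2.2.1
      have := hle hsp
      simp [hx] at this
    have h4 := h3.comp ![1, 2, 0] (by decide)
    convert h4 using 1
    ext i; fin_cases i <;> rfl
  obtain ⟨w, hw⟩ := exists_T_eq_one hV hzx
  obtain ⟨x', hx', hT⟩ : ∃ x', Q.D Q.pole x' = 0 ∧ Q.T z x x' = 1 :=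
    ⟨w + Q.D Q.pole w • x, by simp [hx, CharTwo.add_self_eq_zero], by simp [hw]⟩
  clear hw hz hzx w
  obtain ⟨z, hiso, hT, hzx⟩ : ∃ z, Q.Isotropic Q.pole z ∧ Q.T z x x' = 1 ∧ Q.D z x = 0 := by
    obtain ⟨s, hs⟩ := IsAlgClosed.exists_pow_nat_eq (Q.D z x) (n := 2) (by norm_num)
    exact ⟨z + s • Q.pole, by simpa [add_comm] using hiso.comb 1 0 s 1, by simp [hT],
      by simp [hx, hs, CharTwo.add_self_eq_zero]⟩
  have hTx : Q.T x x' z = 1 := by rw [Q.T_swap₂₃, Q.T_swap₁₂, hT]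
  obtain ⟨hpp, hzz, hpz, hzp⟩ := hiso
  -- The plane of the line and `q = x + y • x'` meets the surface in the line and a conic; the
  -- quintic says that this conic is singular at the point `z + s • pole` of the line.
  obtain ⟨y, hy⟩ := exists_quintic_root (Q.D x z ^ 2) (Q.D z x' * Q.D x Q.pole ^ 2) 1 0
    (Q.D x' z ^ 2) (Q.D z x' * Q.D x' Q.pole ^ 2) (by simp)
  obtain ⟨s, hs⟩ := IsAlgClosed.exists_pow_nat_eq (y * Q.D z x') (n := 2) (by norm_num)
  set q := x + y • x' with hq
  have hqz : Q.D q z = Q.D x z + y ^ 2 * Q.D x' z + y := by simp [hq, hTx]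
  have hqp : Q.D q Q.pole = Q.D x Q.pole + y ^ 2 * Q.D x' Q.pole := by simp [hq]
  have hzq : Q.D z q = y * Q.D z x' := by simp [hq, hzx]
  have hpq : Q.D Q.pole q = 1 := by simp [hq, hx, hx']
  have huq : Q.D (z + s • Q.pole) q = 0 := by
    simp [hzq, hpq, hs, CharTwo.add_self_eq_zero]
  have hqu : Q.D q (z + s • Q.pole) = 0 := by
    have : (Q.D q (z + s • Q.pole)) ^ 2 = 0 := by
      simp only [map_add, map_smul, smul_eq_mul, hqz, hqp]
      linear_combination hy + (Q.D x Q.pole + y ^ 2 * Q.D x' Q.pole) ^ 2 * hs +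
        (y ^ 2 * Q.D x z * Q.D x' z + y * Q.D x z + y ^ 3 * Q.D x' z +
          s * (Q.D x z + y ^ 2 * Q.D x' z + y) * (Q.D x Q.pole + y ^ 2 * Q.D x' Q.pole) +
          y ^ 3 * Q.D z x' * Q.D x Q.pole * Q.D x' Q.pole) * two
    exact pow_eq_zero_iff two_ne_zero |>.mp this
  -- the conic contains a line through `z + s • pole`
  obtain ⟨l, hl⟩ := exists_quintic_root (Q.D q q) (Q.D q Q.pole) 1 0 0 0 (by simp)
  refine ⟨z + s • Q.pole, q + l • Q.pole, ?_, ?_, ?_, ?_, ?_⟩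
  · refine linearIndependent_pole_pair_of_T hp (w := x') ?_
    simp [hq, hT]
  · simp [hzz, hpp, hzp, hpz]
  · simp [hpq, hpp]
    linear_combination hl
  · rw [map_add, huq]
    simp [hzp, hpp]
  · rw [Q.D_add, hqu]
    simp [hpz, hpp]

end CubicPolar
end CubicSurface

/-! ### Elimination for the equations of a line -/

namespace CubicSurface

section Elimination

open Polynomial

variable {k : Type*} [Field k]

theorem derivative_sq_mul [CharP k 2] (f g : k[X]) :
    derivative (f ^ 2 * g) = f ^ 2 * derivative g := by
  have two : C (2 : k) = 0 := by rw [CharTwo.two_eq_zero, map_zero]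
  rw [derivative_mul, derivative_sq, two]
  ring

variable [IsAlgClosed k]

theorem exists_eval_eq_zero_of_derivative_ne_zero {P : k[X]} (h : derivative P ≠ 0) :
    ∃ y, P.eval y = 0 := by
  refine IsAlgClosed.exists_root P fun h0 => h ?_
  rw [eq_C_of_degree_eq_zero h0, derivative_C]

theorem exists_sextic_root (c₀ c₁ c₂ c₃ c₄ : k) :
    ∃ y, y ^ 6 + c₄ * y ^ 4 + c₃ * y ^ 3 + c₂ * y ^ 2 + c₁ * y + c₀ = 0 := by
  let P : k[X] := X ^ 6 + C c₄ * X ^ 4 + C c₃ * X ^ 3 + C c₂ * X ^ 2 + C c₁ * X + C c₀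
  obtain ⟨y, hy⟩ := exists_eval_eq_zero_of_coeff_ne_zero (P := P) (n := 6) (by norm_num)
    (by simp [P, coeff_X_pow])
  exact ⟨y, by simpa [P] using hy⟩

/-- The equations for a line on the surface `p x² + p² y + ⋯` whose equation is normalized at a
point `p` of the surface that lies on none of its lines. Elimination leaves one equation of degree
27 in `b`, whose derivative is a power of `b² + yz`. -/
theorem exists_line_parameters_of_pole_mem [CharP k 2] (xx xy xz yx yy yz c : k) :
    ∃ a b r s : k, r = xx + a * xz + a ^ 3 ∧ s = xy + r ^ 2 + a * c + b * (xz + a ^ 2) ∧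
      a * (b ^ 2 + yz) + (yx + b * c) = 0 ∧ s ^ 2 + (yy + b * yz + b ^ 3) = 0 := by
  have two : (2 : k) = 0 := CharTwo.two_eq_zero
  let D : k[X] := X ^ 2 * 1 + C yz
  let N : k[X] := C c * X + C yx
  let S : k[X] := C xy * D ^ 6 + (C xx * D ^ 3 + N * C xz * D ^ 2 + N ^ 3) ^ 2 + N * C c * D ^ 5 +
    X * C xz * D ^ 6 + X * N ^ 2 * D ^ 4
  let P : k[X] := S ^ 2 * 1 + (D ^ 6) ^ 2 * (C yy + X * D)
  have hD : derivative D = 0 := by simp only [D, derivative_add, derivative_sq_mul]; simp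
  have hDm : D.Monic := by simp only [D, mul_one]; exact monic_X_pow_add_C _ two_ne_zero
  obtain ⟨b, hb⟩ := exists_eval_eq_zero_of_derivative_ne_zero (P := P) (by
    simp only [P, derivative_add, derivative_sq_mul]
    simp only [derivative_mul, derivative_one, derivative_C, derivative_X, hD, mul_zero, zero_add,
      add_zero, one_mul]
    exact mul_ne_zero (pow_ne_zero _ (pow_ne_zero _ hDm.ne_zero)) hDm.ne_zero)
  obtain ⟨d, hd⟩ : ∃ d, d = b ^ 2 + yz := ⟨_, rfl⟩
  obtain ⟨n, hn⟩ : ∃ n, n = c * b + yx := ⟨_, rfl⟩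
  have hDb : D.eval b = d := by simp [D, hd]
  have hNb : N.eval b = n := by simp [N, hn]
  simp only [P, S, eval_add, eval_mul, eval_pow, eval_C, eval_X, eval_one, hDb, hNb] at hb
  by_cases hd0 : d = 0
  · have hn0 : n = 0 := by
      rw [hd0] at hb
      have : n ^ 12 = 0 := by linear_combination hb
      exact pow_eq_zero_iff (by norm_num) |>.mp this
    obtain ⟨t, ht⟩ := IsAlgClosed.exists_pow_nat_eq (yy + b * yz + b ^ 3) (n := 2) (by norm_num)
    obtain ⟨a, ha⟩ := exists_sextic_root (xy + xx ^ 2 + b * xz + t) c (xz ^ 2 + b) 0 0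
    refine ⟨a, b, _, _, rfl, rfl, ?_, ?_⟩
    · linear_combination a * hd0 - a * hd + hn0 - hn
    · have hs : xy + (xx + a * xz + a ^ 3) ^ 2 + a * c + b * (xz + a ^ 2) = t := by
        linear_combination ha + two * (xx * a * xz + xx * a ^ 3 + xz * a ^ 4 - t)
      rw [hs, ht, CharTwo.add_self_eq_zero]
  · refine ⟨n / d, b, _, _, rfl, rfl, ?_, ?_⟩
    · rw [← hd, div_mul_cancel₀ _ hd0, hn]
      linear_combination two * (c * b + yx)
    · have h3 : yy + b * yz + b ^ 3 = yy + b * d := by rw [hd]; ring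
      rw [h3]
      field_simp
      linear_combination hb

/-- The equations for a line on the surface `p³ + p² ℓ(x, y, z) + g(x, y, z)`, with `g` normalized
at a point of the curve `g = 0` that lies on `ℓ = 0`. Here `a` and `s` are eliminated rationally and
`b = σ s`, `s = σ² + l₂` parametrizes the cuspidal cubic `b² = s² (s + l₂)`; an equation of degree
27 in `σ` remains. -/
theorem exists_line_parameters_of_pole_not_mem [CharP k 2] (xy yx l₁ l₂ c : k) :
    ∃ a b r s : k, a = r ^ 3 + l₁ * r ^ 2 ∧ b ^ 2 = s ^ 2 * (s + l₂) ∧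
      s ^ 2 * (r + l₁) + (yx + b * c) = 0 ∧
      xy + a ^ 2 + r ^ 2 * l₂ + a * c + b + s * r ^ 2 = 0 := by
  have two : (2 : k) = 0 := CharTwo.two_eq_zero
  let s : k[X] := X ^ 2 * 1 + C l₂
  let N : k[X] := C c * X * s + C yx
  let R : k[X] := N + C l₁ * s ^ 2
  let P : k[X] := (R * s ^ 4 * X + R ^ 2 * N) ^ 2 * 1 + (s ^ 6) ^ 2 * (C xy + s * X) +
    (R * s ^ 3) ^ 2 * (C c * N)
  have hs : derivative s = 0 := by simp only [s, derivative_add, derivative_sq_mul]; simp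
  have hsm : s.Monic := by simp only [s, mul_one]; exact monic_X_pow_add_C _ two_ne_zero
  have hN : derivative N = C c * s := by simp [N, hs]
  have hne : s ^ 3 + C c * R ≠ 0 := by
    intro h
    have := congrArg (fun p => coeff p 6) h
    have e : s ^ 3 + C c * R = X ^ 6 + C (3 * l₂ + c * l₁) * X ^ 4 + C (c ^ 2) * X ^ 3 +
        C (3 * l₂ ^ 2 + 2 * c * l₁ * l₂) * X ^ 2 + C (c ^ 2 * l₂) * X +
        C (l₂ ^ 3 + c * yx + c * l₁ * l₂ ^ 2) := by
      simp only [s, R, N, map_add, map_mul, map_pow, map_ofNat]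
      ring
    rw [e] at this
    simp only [coeff_add, coeff_C_mul, coeff_X_pow, coeff_C, coeff_X, coeff_zero] at this
    norm_num at this
  obtain ⟨σ, hσ⟩ := exists_eval_eq_zero_of_derivative_ne_zero (P := P) (by
    have : derivative P = s ^ 7 * (s ^ 3 + C c * R) ^ 2 := by
      simp only [P, derivative_add, derivative_sq_mul]
      simp only [derivative_mul, derivative_one, derivative_C, derivative_X, hs, hN]
      rw [CharTwo.add_sq (s ^ 3)]
      ring
    rw [this]
    exact mul_ne_zero (pow_ne_zero _ hsm.ne_zero) (pow_ne_zero _ hne))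
  obtain ⟨t, ht⟩ : ∃ t, t = σ ^ 2 + l₂ := ⟨_, rfl⟩
  obtain ⟨n, hn⟩ : ∃ n, n = c * σ * t + yx := ⟨_, rfl⟩
  have hst : s.eval σ = t := by simp [s, ht]
  have hNn : N.eval σ = n := by
    simp only [N, eval_add, eval_mul, eval_C, eval_X, hst, hn]
  simp only [P, R, eval_add, eval_mul, eval_pow, eval_C, eval_X, eval_one, hst, hNn] at hσ
  have h2 : σ ^ 2 = t + l₂ := by rw [ht]; linear_combination - two * l₂
  by_cases ht0 : t = 0
  · have hn0 : n = 0 := by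
      rw [ht0] at hσ
      have : n ^ 6 = 0 := by linear_combination hσ
      exact pow_eq_zero_iff (by norm_num) |>.mp this
    have hyx : yx = 0 := by rw [hn, ht0] at hn0; linear_combination hn0
    obtain ⟨r, hr⟩ := exists_sextic_root xy 0 (l₁ * c + l₂) c (l₁ ^ 2)
    refine ⟨_, 0, r, 0, rfl, by ring, by rw [hyx]; ring, ?_⟩
    linear_combination hr + two * (r ^ 5 * l₁)
  · refine ⟨_, σ * t, (n + l₁ * t ^ 2) / t ^ 2, t, rfl, ?_, ?_, ?_⟩
    · linear_combination t ^ 2 * h2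
    · field_simp
      linear_combination hn + two * (c * σ * t + yx + l₁ * t ^ 2)
    · have h1 : ((n + l₁ * t ^ 2) / t ^ 2) ^ 3 + l₁ * ((n + l₁ * t ^ 2) / t ^ 2) ^ 2 =
          (n + l₁ * t ^ 2) ^ 2 * n / t ^ 6 := by
        field_simp
        linear_combination two * (l₁ * t ^ 2 * (n + l₁ * t ^ 2) ^ 2)
      rw [h1]
      field_simp
      linear_combination hσ - h2 * (n + l₁ * t ^ 2) ^ 2 * t ^ 8 -
        two * ((n + l₁ * t ^ 2) ^ 3 * t ^ 4 * σ * n)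

end Elimination

namespace CubicPolar

variable {k V : Type*} [Field k] [AddCommGroup V] [Module k V] {Q : CubicPolar k V}
  [IsAlgClosed k]

/-- A two-dimensional family of vectors contains a point of the cubic surface. -/
theorem exists_D_self_eq_zero {u v w : V} (h : Q.T u v w = 1) :
    ∃ a b c d : k, Q.D (a • u + b • v) (a • u + b • v) = 0 ∧
      Q.T (a • u + b • v) (c • u + d • v) w = 1 := by
  by_cases hv : Q.D v v = 0
  · exact ⟨0, 1, 1, 0, by simp [hv], by simp [Q.T_swap₁₂ v u, h]⟩
  · obtain ⟨t, ht⟩ := exists_quintic_root (Q.D u u) (Q.D u v) (Q.D v u) (Q.D v v) 0 0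
      (fun h => hv h.2.2.1)
    refine ⟨1, t, 0, 1, ?_, by simp [h]⟩
    simp
    linear_combination ht

end CubicPolar

end CubicSurface

/-! ### Existence of a line, and of a triangle -/

namespace CubicSurface

namespace CubicPolar

variable {k V : Type*} [Field k] [AddCommGroup V] [Module k V] {Q : CubicPolar k V}

theorem linearIndependent_pole_single_of_T (hp : Q.pole ≠ 0) {u v w : V} (h : Q.T u v w ≠ 0) :
    LinearIndependent k ![Q.pole, u] := by
  have := (linearIndependent_pole_of_T hp h).comp ![0, 1] (by decide)
  convert this using 1
  ext i; fin_cases i <;> rfl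

theorem exists_pair_T_eq_one (hV : Module.finrank k V = 4) {u : V}
    (h : LinearIndependent k ![Q.pole, u]) : ∃ v w, Q.T u v w = 1 := by
  obtain ⟨v, hv⟩ := exists_linearIndependent_snoc_of_lt_finrank h (by rw [hV]; norm_num)
  have h3 : (Fin.snoc ![Q.pole, u] v : Fin 3 → V) = ![Q.pole, u, v] := by
    ext i; fin_cases i <;> rfl
  exact ⟨v, exists_T_eq_one hV (h3 ▸ hv)⟩

variable [IsAlgClosed k] [CharP k 2]

/-- If the pole lies on a smooth cubic surface, the surface contains a line: one through the pole,
or else one given by the elimination in a frame adapted to the pole. -/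
theorem Smooth.exists_line_of_D_pole_eq_zero (hs : Q.Smooth) (hV : Module.finrank k V = 4)
    (hp : Q.pole ≠ 0) (hpp : Q.D Q.pole Q.pole = 0) :
    ∃ u v, LinearIndependent k ![u, v] ∧ Q.Isotropic u v := by
  have two : (2 : k) = 0 := CharTwo.two_eq_zero
  obtain ⟨y, hy⟩ : ∃ y, Q.D Q.pole y = 1 := by
    obtain ⟨x, hx⟩ := hs Q.pole hp
    exact ⟨(Q.D Q.pole x)⁻¹ • x, by simp [hx]⟩
  have hyp : LinearIndependent k ![Q.pole, y] := by
    rw [LinearIndependent.pair_iff' hp]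
    rintro c rfl
    simp [hpp] at hy
  -- `z` and `v` span, with the pole, the tangent plane at the pole
  obtain ⟨z, v, hT, hz, hv, hzp⟩ : ∃ z v, Q.T z v y = 1 ∧ Q.D Q.pole z = 0 ∧
      Q.D Q.pole v = 0 ∧ Q.D z Q.pole = 0 := by
    obtain ⟨v, w, hT⟩ := exists_pair_T_eq_one hV hyp
    obtain ⟨v, w, hT, hv, hw⟩ : ∃ v w, Q.T v w y = 1 ∧ Q.D Q.pole v = 0 ∧ Q.D Q.pole w = 0 := by
      refine ⟨v + Q.D Q.pole v • y, w + Q.D Q.pole w • y, ?_, ?_, ?_⟩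
      · simp only [T_add, T_smul, T_add_mid, T_smul_mid, T_self₂₃, T_self₁₃]
        rw [Q.T_swap₂₃, Q.T_swap₁₂, hT]
        ring
      · simp [hy, CharTwo.add_self_eq_zero]
      · simp [hy, CharTwo.add_self_eq_zero]
    by_cases h : Q.D w Q.pole = 0
    · exact ⟨w, v, by rw [Q.T_swap₁₂, hT], hw, hv, h⟩
    · obtain ⟨t, ht⟩ := IsAlgClosed.exists_pow_nat_eq (Q.D v Q.pole / Q.D w Q.pole) (n := 2)
        (by norm_num)
      refine ⟨v + t • w, w, by simp [hT], by simp [hv, hw], hw, ?_⟩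
      simp [ht, h, CharTwo.add_self_eq_zero]
  by_cases hvp : Q.D v Q.pole = 0
  · -- the tangent plane meets the surface in lines through the pole
    obtain ⟨a, b, c, d, h1, h2⟩ := exists_D_self_eq_zero hT
    refine ⟨_, _, linearIndependent_pole_single_of_T hp (h2.trans_ne one_ne_zero), hpp, h1, ?_, ?_⟩
    · simp [hz, hv]
    · simp [hzp, hvp]
  by_cases hzz : Q.D z z = 0
  · exact ⟨_, _, linearIndependent_pole_single_of_T hp (hT.trans_ne one_ne_zero), hpp, hzz, hz, hzp⟩
  -- normalize the frame
  obtain ⟨z, hT, hz, hzp, hzz⟩ : ∃ z, Q.T z v y ≠ 0 ∧ Q.D Q.pole z = 0 ∧ Q.D z Q.pole = 0 ∧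
      Q.D z z = 1 := by
    obtain ⟨g, hg⟩ := IsAlgClosed.exists_pow_nat_eq (Q.D z z)⁻¹ (n := 3) (by norm_num)
    have hg0 : g ≠ 0 := by rintro rfl; simp at hg; exact hzz hg.symm
    refine ⟨g • z, by simp [hT, hg0], by simp [hz], by simp [hzp], ?_⟩
    have : g ^ 3 * Q.D z z = 1 := by rw [hg, inv_mul_cancel₀ hzz]
    simp
    linear_combination this
  obtain ⟨x, hT, hxp, hpx, hzx⟩ : ∃ x, Q.T z x y ≠ 0 ∧ Q.D x Q.pole = 1 ∧ Q.D Q.pole x = 0 ∧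
      Q.D z x = 0 := by
    obtain ⟨g, hg⟩ := IsAlgClosed.exists_pow_nat_eq (Q.D v Q.pole)⁻¹ (n := 2) (by norm_num)
    have hg0 : g ≠ 0 := by rintro rfl; simp at hg; exact hvp hg.symm
    refine ⟨g • v + (g * Q.D z v) • z, by simp [hT, hg0], by simp [hg, hvp, hzp],
      by simp [hv, hz], by simp [hzz, CharTwo.add_self_eq_zero]⟩
  obtain ⟨y, hT, hyp, hpy, hzy⟩ : ∃ y, Q.T z x y ≠ 0 ∧ Q.D y Q.pole = 0 ∧ Q.D Q.pole y = 1 ∧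
      Q.D z y = 0 := by
    obtain ⟨t, ht⟩ := IsAlgClosed.exists_pow_nat_eq (Q.D y Q.pole) (n := 2) (by norm_num)
    refine ⟨y + t • x + Q.D z y • z, by simp [hT],
      by simp [ht, hxp, hzp, CharTwo.add_self_eq_zero], by simp [hy, hpx, hz],
      by simp [hzx, hzz, CharTwo.add_self_eq_zero]⟩
  obtain ⟨a, b, r, s, h1, h2, h3, h4⟩ := exists_line_parameters_of_pole_mem (Q.D x x) (Q.D x y)
    (Q.D x z) (Q.D y x) (Q.D y y) (Q.D y z) (Q.T z x y)
  have hTxyz : Q.T x y z = Q.T z x y := by rw [Q.T_swap₂₃, Q.T_swap₁₂]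
  have hTxzy : Q.T x z y = Q.T z x y := by rw [Q.T_swap₁₂]
  have hTyzx : Q.T y z x = Q.T z x y := by rw [Q.T_swap₁₂, Q.T_swap₂₃]
  refine ⟨x + a • z + r • Q.pole, y + b • z + s • Q.pole,
    linearIndependent_pair_of_T (Q := Q) (w := z) ?_, ?_, ?_, ?_, ?_⟩
  · simpa [hTxyz] using hT
  · simp [hz, hpp, hpx, hxp, hzx, hzz, hzp]
    linear_combination h1 + two * (Q.D x x + a * Q.D x z + a ^ 3)
  · simp [hz, hpp, hpy, hyp, hzy, hzz, hzp]
    linear_combination h4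
  · simp [hz, hpp, hpy, hxp, hzy, hzz, hzp, hTxzy]
    linear_combination h2 + two * (Q.D x y + r ^ 2 + a * Q.T z x y + b * (Q.D x z + a ^ 2))
  · simp [hz, hpp, hpx, hyp, hzx, hzz, hzp, hTyzx]
    linear_combination h3

/-- If the pole does not lie on a smooth cubic surface, the surface contains a line: one through a
flex of a plane section, or else one given by the elimination in an adapted frame. -/
theorem Smooth.exists_line_of_D_pole_ne_zero (hs : Q.Smooth) (hV : Module.finrank k V = 4)
    (hp : Q.pole ≠ 0) (hpp : Q.D Q.pole Q.pole ≠ 0) :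
    ∃ u v, LinearIndependent k ![u, v] ∧ Q.Isotropic u v := by
  have two : (2 : k) = 0 := CharTwo.two_eq_zero
  -- rescale the pole
  obtain ⟨g, hg0, hg⟩ : ∃ g : k, g ≠ 0 ∧ g ^ 3 * Q.D Q.pole Q.pole = 1 := by
    obtain ⟨g, hg⟩ := IsAlgClosed.exists_pow_nat_eq (Q.D Q.pole Q.pole)⁻¹ (n := 3) (by norm_num)
    refine ⟨g, by rintro rfl; simp at hg; exact hpp hg.symm, by rw [hg, inv_mul_cancel₀ hpp]⟩
  obtain ⟨e, he⟩ : ∃ e, e = g • Q.pole := ⟨_, rfl⟩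
  have hee : Q.D e e = 1 := by simp [he]; linear_combination hg
  have hT₁ : ∀ u v, Q.T e u v = 0 := by simp [he]
  have hT₂ : ∀ u v, Q.T u e v = 0 := by simp [he]
  have hT₃ : ∀ u v, Q.T u v e = 0 := by simp [he]
  have hpe : ∀ x, Q.D x e = 0 → Q.D x Q.pole = 0 := by
    intro x hx
    simpa [he, hg0] using hx
  -- `D · e` is additive, as `T` vanishes on `e`, so `D · e = 0` defines a plane off the pole
  obtain ⟨u₁, u₂, u₃, hT, hu₁, hu₂, hu₃⟩ : ∃ u₁ u₂ u₃, Q.T u₁ u₂ u₃ = 1 ∧ Q.D u₁ e = 0 ∧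
      Q.D u₂ e = 0 ∧ Q.D u₃ e = 0 := by
    obtain ⟨w, hw⟩ := exists_linearIndependent_snoc_of_lt_finrank
      (linearIndependent_unique_iff (R := k) (v := ![Q.pole]) |>.mpr hp) (by rw [hV]; norm_num)
    have h3 : (Fin.snoc ![Q.pole] w : Fin 2 → V) = ![Q.pole, w] := by
      ext i; fin_cases i <;> rfl
    rw [h3] at hw
    obtain ⟨v, x, hT⟩ := exists_pair_T_eq_one hV hw
    have key : ∀ v, ∃ s : k, Q.D (v + s • e) e = 0 := by
      intro v
      obtain ⟨s, hs⟩ := IsAlgClosed.exists_pow_nat_eq (Q.D v e) (n := 2) (by norm_num)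
      exact ⟨s, by simp [hee, hs, CharTwo.add_self_eq_zero]⟩
    obtain ⟨s₁, h₁⟩ := key w
    obtain ⟨s₂, h₂⟩ := key v
    obtain ⟨s₃, h₃⟩ := key x
    exact ⟨_, _, _, by simp [hT₁, hT₂, hT₃, hT], h₁, h₂, h₃⟩
  -- `v₁` and `v₂` span the line of that plane on which `D e` vanishes
  obtain ⟨v₁, v₂, v₃, hT, hv₁, hv₂, hv₃, he₁, he₂⟩ : ∃ v₁ v₂ v₃, Q.T v₁ v₂ v₃ = 1 ∧ Q.D v₁ e = 0 ∧
      Q.D v₂ e = 0 ∧ Q.D v₃ e = 0 ∧ Q.D e v₁ = 0 ∧ Q.D e v₂ = 0 := by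
    by_cases h3 : Q.D e u₃ = 0
    · by_cases h2 : Q.D e u₂ = 0
      · exact ⟨u₂, u₃, u₁, by rw [Q.T_swap₂₃, Q.T_swap₁₂, hT], hu₂, hu₃, hu₁, h2, h3⟩
      · refine ⟨u₁ + (Q.D e u₁ / Q.D e u₂) • u₂, u₃, u₂, ?_, ?_, hu₃, hu₂, ?_, h3⟩
        · simp; rw [Q.T_swap₂₃, hT]
        · simp [hu₁, hu₂, hT₃]
        · simp [h2, CharTwo.add_self_eq_zero]
    · refine ⟨u₁ + (Q.D e u₁ / Q.D e u₃) • u₃, u₂ + (Q.D e u₂ / Q.D e u₃) • u₃, u₃, ?_, ?_, ?_, hu₃,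
        ?_, ?_⟩
      · simp [hT]
      · simp [hu₁, hu₃, hT₃]
      · simp [hu₂, hu₃, hT₃]
      · simp [h3, CharTwo.add_self_eq_zero]
      · simp [h3, CharTwo.add_self_eq_zero]
  obtain ⟨z, z', hT, hz, hz', hez, hzz⟩ : ∃ z z', Q.T z z' v₃ = 1 ∧ Q.D z e = 0 ∧ Q.D z' e = 0 ∧
      Q.D e z = 0 ∧ Q.D z z = 0 := by
    obtain ⟨a, b, c, d, h1, h2⟩ := exists_D_self_eq_zero hT
    exact ⟨_, _, h2, by simp [hv₁, hv₂, hT₃], by simp [hv₁, hv₂, hT₃], by simp [he₁, he₂], h1⟩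
  have hz0 : z ≠ 0 := CubicPolar.ne_zero_of_T (hT.trans_ne one_ne_zero)
  -- `x` spans, with `z`, the tangent line at `z` of the section by the plane `D · e = 0`
  obtain ⟨x, y, hT, hx, hy, hzx, hzy⟩ : ∃ x y, Q.T z x y ≠ 0 ∧ Q.D x e = 0 ∧ Q.D y e = 0 ∧
      Q.D z x = 0 ∧ Q.D z y = 1 := by
    by_cases h : Q.D z v₃ = 0
    · have h' : Q.D z z' ≠ 0 := by
        refine hs.ne_zero_of_T hV hp (u := z) (v := v₃) ?_ hz0 (hpe z hz) hzz h
        rw [Q.T_swap₂₃, hT]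
        exact one_ne_zero
      refine ⟨v₃, (Q.D z z')⁻¹ • z', ?_, hv₃, by simp [hz'], h, by simp [h']⟩
      simp only [T_smul_right]
      rw [Q.T_swap₂₃, hT]
      simpa using h'
    · exact ⟨z' + (Q.D z z' / Q.D z v₃) • v₃, (Q.D z v₃)⁻¹ • v₃, by simp [hT, h],
        by simp [hz', hv₃, hT₃], by simp [hv₃], by simp [h, CharTwo.add_self_eq_zero], by simp [h]⟩
  by_cases hxz : Q.D x z = 0
  · -- the section has a flex at `z`, and the plane of its tangent line and `e` contains a line
    obtain ⟨t, ht⟩ := exists_quintic_root (Q.D x x) 0 (Q.D e x) 1 0 0 (by simp)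
    refine ⟨z, x + t • e, linearIndependent_pair_of_T (Q := Q) (w := y) ?_, hzz, ?_, ?_, ?_⟩
    · simpa [hT₂] using hT
    · simp [hx, hee]
      linear_combination ht
    · simp [hzx, hz]
    · simp [hT₂, hxz, hez]
  obtain ⟨x, hT, hx, hzx, hxz, hxx⟩ : ∃ x, Q.T z x y ≠ 0 ∧ Q.D x e = 0 ∧ Q.D z x = 0 ∧
      Q.D x z = 1 ∧ Q.D x x = 0 := by
    obtain ⟨l, hl⟩ := IsAlgClosed.exists_pow_nat_eq (Q.D x z)⁻¹ (n := 2) (by norm_num)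
    have hl0 : l ≠ 0 := by rintro rfl; simp at hl; exact hxz hl.symm
    have h1 : l ^ 2 * Q.D x z = 1 := by rw [hl, inv_mul_cancel₀ hxz]
    refine ⟨l • x + (l ^ 3 * Q.D x x) • z, by simp [hT, hl0], by simp [hx, hz, hT₃],
      by simp [hzx, hzz], by simp [h1, hzz], ?_⟩
    simp [hzx, hzz]
    right
    linear_combination l * Q.D x x * h1 + l * Q.D x x * two
  obtain ⟨y, hT, hy, hzy, hyz, hyy⟩ : ∃ y, Q.T z x y ≠ 0 ∧ Q.D y e = 0 ∧ Q.D z y = 1 ∧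
      Q.D y z = 0 ∧ Q.D y y = 0 := by
    obtain ⟨l, hl⟩ := exists_quintic_root (Q.D y z) (Q.T y x z) 1 0 0 0 (by simp)
    obtain ⟨y, hT, hy, hzy, hyz⟩ : ∃ y, Q.T z x y ≠ 0 ∧ Q.D y e = 0 ∧ Q.D z y = 1 ∧
        Q.D y z = 0 := by
      refine ⟨y + l • x, by simp [hT], by simp [hx, hy, hT₃], by simp [hzx, hzy], ?_⟩
      simp [hxz]
      linear_combination hl
    obtain ⟨t, ht⟩ := IsAlgClosed.exists_pow_nat_eq (Q.D y y) (n := 2) (by norm_num)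
    exact ⟨y + t • z, by simp [hT], by simp [hy, hz, hT₃], by simp [hzy, hzz],
      by simp [hyz, hzz], by simp [hyz, hzz, hzy, ht, CharTwo.add_self_eq_zero]⟩
  obtain ⟨a, b, r, s, h1, h2, h3, h4⟩ := exists_line_parameters_of_pole_not_mem (Q.D x y)
    (Q.D y x) (Q.D e x) (Q.D e y) (Q.T z x y)
  have hTxyz : Q.T x y z = Q.T z x y := by rw [Q.T_swap₂₃, Q.T_swap₁₂]
  have hTxzy : Q.T x z y = Q.T z x y := by rw [Q.T_swap₁₂]
  have hTyzx : Q.T y z x = Q.T z x y := by rw [Q.T_swap₁₂, Q.T_swap₂₃]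
  refine ⟨x + a • z + r • e, y + b • z + s • e,
    linearIndependent_pair_of_T (Q := Q) (w := z) ?_, ?_, ?_, ?_, ?_⟩
  · simpa [hTxyz, hT₁, hT₂] using hT
  · simp [hT₃, hxx, hzx, hxz, hzz, hez, hx, hz, hee]
    linear_combination h1 + two * (r ^ 3 + Q.D e x * r ^ 2)
  · simp [hT₃, hyy, hzy, hyz, hzz, hez, hy, hz, hee]
    linear_combination h2 + two * (s ^ 3 + Q.D e y * s ^ 2)
  · simp [hT₂, hT₃, hzy, hxz, hzz, hez, hx, hz, hee, hTxzy]
    linear_combination h4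
  · simp [hT₂, hT₃, hzx, hyz, hzz, hez, hy, hz, hee, hTyzx]
    linear_combination h3

/-- A smooth cubic surface with nonzero pole contains a triangle of lines. -/
theorem Smooth.exists_triangle_of_pole_ne_zero (hs : Q.Smooth) (hV : Module.finrank k V = 4)
    (hp : Q.pole ≠ 0) :
    ∃ u₁ u₂ q, LinearIndependent k ![u₁, u₂, q] ∧ Q.Isotropic u₁ u₂ ∧ Q.Isotropic u₁ q ∧
      Q.Isotropic u₂ q := by
  obtain ⟨u, v, huv, hiso⟩ : ∃ u v, LinearIndependent k ![u, v] ∧ Q.Isotropic u v := by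
    by_cases hpp : Q.D Q.pole Q.pole = 0
    · exact hs.exists_line_of_D_pole_eq_zero hV hp hpp
    · exact hs.exists_line_of_D_pole_ne_zero hV hp hpp
  by_cases hli : LinearIndependent k ![Q.pole, u, v]
  · exact hs.exists_triangle hV hp hli hiso
  obtain ⟨a, b, hab⟩ : ∃ a b : k, a • u + b • v = Q.pole := by
    by_contra! H
    refine hli (linearIndependent_finCons.mpr ⟨huv, fun h => ?_⟩)
    obtain ⟨g, hg⟩ := (Submodule.mem_span_range_iff_exists_fun k).mp h
    exact H (g 0) (g 1) (by simpa using hg)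
  obtain ⟨z, hz, hpz⟩ : ∃ z, LinearIndependent k ![Q.pole, z] ∧ Q.Isotropic Q.pole z := by
    rw [LinearIndependent.pair_iff] at huv
    by_cases hb : b = 0
    · refine ⟨v, ?_, by simpa [hab] using hiso.comb a b 0 1⟩
      rw [LinearIndependent.pair_iff]
      intro s t hst
      rw [← hab, hb] at hst
      have ha : a ≠ 0 := by rintro rfl; simp [hb] at hab; exact hp hab.symm
      obtain ⟨h1, h2⟩ := huv (s * a) t (by simpa [smul_smul] using hst)
      simp [ha] at h1
      exact ⟨h1, h2⟩
    · refine ⟨u, ?_, by simpa [hab] using hiso.comb a b 1 0⟩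
      rw [LinearIndependent.pair_iff]
      intro s t hst
      rw [← hab] at hst
      obtain ⟨h1, h2⟩ := huv (s * a + t) (s * b) (by rw [← hst]; module)
      have hs0 : s = 0 := by simpa [hb] using h2
      exact ⟨hs0, by simpa [hs0] using h1⟩
  obtain ⟨u, v, huv, hiso⟩ := hs.exists_line_avoiding_pole hV hp hz hpz
  exact hs.exists_triangle hV hp huv hiso

end CubicPolar

end CubicSurface

/-! ### Rational vectors of a form that is quadratic in one argument -/

namespace CubicSurface

section Fixed

variable {k V : Type*} [Field k] [AddCommGroup V] [Module k V]

open Polynomial in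
/-- The polynomials that give, in terms of the last coordinate, the coordinates of a fixed vector of
a semilinear map `ψ` with respect to a cyclic basis `v, ψ v, ψ² v, …`, where `ψ` takes the last
basis vector to the combination with coefficients `c`. -/
noncomputable def fixedVectorPoly (c : ℕ → k) : ℕ → k[X]
  | 0 => C (c 0) * X ^ 4
  | n + 1 => fixedVectorPoly c n ^ 4 + C (c (n + 1)) * X ^ 4

open Polynomial in
theorem fixedVectorPoly_degree (c : ℕ → k) (n : ℕ) :
    (fixedVectorPoly c n = 0 ∧ ∀ i ≤ n, c i = 0) ∨ 4 ≤ (fixedVectorPoly c n).natDegree := by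
  induction n with
  | zero =>
    by_cases h : c 0 = 0
    · left
      simp [fixedVectorPoly, h]
    · right
      rw [fixedVectorPoly, natDegree_C_mul_X_pow _ _ h]
  | succ n ih =>
    rcases ih with ⟨h0, hc⟩ | h4
    · by_cases h : c (n + 1) = 0
      · left
        refine ⟨by simp [fixedVectorPoly, h, h0], fun i hi => ?_⟩
        rcases Nat.lt_or_ge n i with h' | h'
        · rwa [show i = n + 1 by omega]
        · exact hc i h'
      · right
        rw [fixedVectorPoly, h0, zero_pow (by norm_num), zero_add, natDegree_C_mul_X_pow _ _ h]
    · right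
      have h1 : (C (c (n + 1)) * X ^ 4 : k[X]).natDegree ≤ 4 := natDegree_C_mul_X_pow_le _ _
      rw [fixedVectorPoly, natDegree_add_eq_left_of_natDegree_lt]
      · rw [natDegree_pow]; omega
      · rw [natDegree_pow]; omega

open Polynomial in
theorem exists_fixedVectorPoly_eq [IsAlgClosed k] (c : ℕ → k) (n : ℕ) (h : ∃ i ≤ n, c i ≠ 0) :
    ∃ y, y ≠ 0 ∧ (fixedVectorPoly c n).eval y = y := by
  have hdvd : ∀ n, (X ^ 4 : k[X]) ∣ fixedVectorPoly c n := by
    intro n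
    induction n with
    | zero => exact Dvd.intro_left _ rfl
    | succ n ih => exact dvd_add (ih.trans (dvd_pow_self _ (by norm_num))) (Dvd.intro_left _ rfl)
  obtain ⟨g, hg⟩ := hdvd n
  have hg0 : g ≠ 0 := by
    rintro rfl
    rcases fixedVectorPoly_degree c n with ⟨-, hc⟩ | h4
    · obtain ⟨i, hi, hci⟩ := h
      exact hci (hc i hi)
    · rw [hg, mul_zero, natDegree_zero] at h4
      omega
  have hdeg : (X ^ 3 * g - 1).degree ≠ 0 := by
    intro h0
    have h1 : (X ^ 3 * g).natDegree = 0 := by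
      have : X ^ 3 * g = (X ^ 3 * g - 1) + C 1 := by rw [map_one]; ring
      rw [this, natDegree_add_C]
      exact natDegree_eq_of_degree_eq_some h0
    rw [natDegree_mul (by simp) hg0, natDegree_X_pow] at h1
    omega
  obtain ⟨y, hy⟩ := IsAlgClosed.exists_root _ hdeg
  have hy : y ^ 3 * g.eval y = 1 := by simpa [sub_eq_zero] using hy
  refine ⟨y, ?_, ?_⟩
  · rintro rfl
    simp at hy
  · rw [hg, eval_mul, eval_pow, eval_X]
    linear_combination y * hy

/-- An injective map of a finite-dimensional space that is semilinear with respect to the fourth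
power Frobenius has enough fixed vectors to span the space: this is the theorem of Lang and
Dieudonné for the general linear group over the field with four elements. -/
theorem span_fixed_eq_top [IsAlgClosed k] [FiniteDimensional k V] (ψ : V →+ V)
    (hψ : ∀ (c : k) v, ψ (c • v) = c ^ 4 • ψ v) (hinj : Function.Injective ψ) :
    Submodule.span k {v | ψ v = v} = ⊤ := by
  set W := Submodule.span k {v | ψ v = v} with hW
  -- on the span of the fixed vectors `ψ - 1` is surjective, as `t⁴ - t = c` is solvable
  have hsub : ∀ w ∈ W, ∃ y ∈ W, ψ y - y = w := by
    intro w hw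
    suffices h : ∀ c : k, ∃ y ∈ W, ψ y - y = c • w by simpa using h 1
    induction hw using Submodule.span_induction with
    | mem x hx =>
      intro c
      obtain ⟨t, ht⟩ := exists_quintic_root (-c) (-1) 0 0 1 0 (by simp)
      refine ⟨t • x, W.smul_mem _ (Submodule.subset_span hx), ?_⟩
      rw [hψ, show ψ x = x from hx, ← sub_smul]
      congr 1
      linear_combination ht
    | zero => exact fun c => ⟨0, W.zero_mem, by simp⟩
    | add x y _ _ hx hy =>
      intro c
      obtain ⟨x', hx', hx⟩ := hx c
      obtain ⟨y', hy', hy⟩ := hy c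
      exact ⟨x' + y', W.add_mem hx' hy', by rw [map_add, smul_add, ← hx, ← hy]; abel⟩
    | smul d x _ hx => exact fun c => by simpa [smul_smul] using hx (c * d)
  -- `ψ` induces an injective map on the quotient by `W`
  have hpre : ∀ u, ψ u ∈ W → u ∈ W := by
    suffices h : ∀ w ∈ W, ∃ y ∈ W, ψ y = w by
      intro u hu
      obtain ⟨y, hy, h⟩ := h _ hu
      rwa [← hinj h]
    intro w hw
    induction hw using Submodule.span_induction with
    | mem x hx => exact ⟨x, Submodule.subset_span hx, hx⟩
    | zero => exact ⟨0, W.zero_mem, map_zero ψ⟩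
    | add x y _ _ hx hy =>
      obtain ⟨x', hx', rfl⟩ := hx
      obtain ⟨y', hy', rfl⟩ := hy
      exact ⟨x' + y', W.add_mem hx' hy', map_add ψ _ _⟩
    | smul d x _ hx =>
      obtain ⟨x', hx', rfl⟩ := hx
      obtain ⟨t, ht⟩ := IsAlgClosed.exists_pow_nat_eq d (n := 4) (by norm_num)
      exact ⟨t • x', W.smul_mem _ hx', by rw [hψ, ht]⟩
  rw [Submodule.eq_top_iff']
  by_contra! hv
  obtain ⟨v, hv⟩ := hv
  let b : ℕ → V := fun i => ψ^[i] v
  have hbs : ∀ i, b (i + 1) = ψ (b i) := fun i => Function.iterate_succ_apply' ψ i v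
  have hbW : ∀ i, b i ∉ W := by
    intro i
    induction i with
    | zero => exact hv
    | succ i ih => exact fun h => ih (hpre _ (hbs i ▸ h))
  -- the cyclic vectors `b i` are eventually dependent modulo `W`
  have hex : ∃ r, ∃ w ∈ W, ∃ c : ℕ → k, b r = w + ∑ i ∈ Finset.range r, c i • b i := by
    by_contra! H
    have hli : ∀ n, LinearIndependent k (fun i : Fin n => b i) := by
      intro n
      induction n with
      | zero => exact linearIndependent_empty_type
      | succ n ih =>
        have : (fun i : Fin (n + 1) => b i) = Fin.snoc (fun i : Fin n => b i) (b n) := by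
          ext i
          refine Fin.lastCases ?_ (fun j => ?_) i <;> simp
        rw [this, linearIndependent_finSnoc]
        refine ⟨ih, fun h => ?_⟩
        obtain ⟨g, hg⟩ := (Submodule.mem_span_range_iff_exists_fun k).mp h
        refine H n 0 W.zero_mem (fun i => if h : i < n then g ⟨i, h⟩ else 0) ?_
        rw [← hg, zero_add, Finset.sum_range]
        simp
    have := (hli (Module.finrank k V + 1)).fintype_card_le_finrank
    simp at this
  classical
  obtain ⟨w, hw, c, hc⟩ := Nat.find_spec hex
  have hmin := fun m => Nat.find_min (m := m) hex
  generalize Nat.find hex = n at *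
  obtain ⟨m, rfl⟩ : ∃ m, n = m + 1 := by
    refine Nat.exists_eq_succ_of_ne_zero ?_
    rintro rfl
    exact hbW 0 (by rw [hc]; simpa using hw)
  -- a nonzero fixed vector `S` modulo `W`, corrected by an element of `W`, is fixed and off `W`
  obtain ⟨y, hy0, hy⟩ := exists_fixedVectorPoly_eq c m (by
    by_contra! H
    refine hbW (m + 1) ?_
    rw [hc, Finset.sum_eq_zero, add_zero]
    · exact hw
    · intro i hi
      rw [H i (by simpa [Nat.lt_succ_iff] using hi), zero_smul])
  let x : ℕ → k := fun i => (fixedVectorPoly c i).eval y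
  have hxm : x m = y := hy
  have hx0 : x 0 = c 0 * y ^ 4 := by simp [x, fixedVectorPoly]
  have hxs : ∀ i, x (i + 1) = x i ^ 4 + c (i + 1) * y ^ 4 := by
    intro i; simp [x, fixedVectorPoly]
  let S := ∑ i ∈ Finset.range (m + 1), x i • b i
  have hS : ψ S - S = y ^ 4 • w := by
    have e1 : ψ S = ∑ i ∈ Finset.range m, x i ^ 4 • b (i + 1) + y ^ 4 • b (m + 1) := by
      simp only [S, map_sum, hψ, ← hbs]
      rw [Finset.sum_range_succ, hxm]
    have e2 : S = ∑ i ∈ Finset.range m, x (i + 1) • b (i + 1) + x 0 • b 0 :=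
      Finset.sum_range_succ' _ _
    rw [e1, e2, hc, Finset.sum_range_succ', hx0]
    simp only [hxs, smul_add, add_smul, Finset.sum_add_distrib, Finset.smul_sum, smul_smul]
    simp only [mul_comm (y ^ 4)]
    abel
  have hSW : S ∉ W := by
    intro h
    refine hmin m (Nat.lt_succ_self m) ⟨y⁻¹ • S, W.smul_mem _ h, fun i => - (y⁻¹ * x i), ?_⟩
    simp only [S, Finset.sum_range_succ, hxm, smul_add, smul_smul, inv_mul_cancel₀ hy0, one_smul,
      Finset.smul_sum, neg_smul, Finset.sum_neg_distrib]
    abel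
  obtain ⟨z, hz, hzS⟩ := hsub _ (W.smul_mem (y ^ 4) hw)
  have hfix : S - z ∈ W := Submodule.subset_span (by
    change ψ (S - z) = S - z
    rw [map_sub]
    have h := hS.trans hzS.symm
    rw [sub_eq_sub_iff_add_eq_add] at h ⊢
    exact h.trans (add_comm _ _))
  exact hSW (by simpa using W.add_mem hfix hz)

end Fixed

section Hermitian

open Matrix

variable {k ι : Type*} [Field k] [Fintype ι]

/-- The form `∑ aᵢⱼ uᵢ² vⱼ`, additive in both arguments, linear in the second and semilinear with
respect to the Frobenius map in the first. -/
def frobForm (A : Matrix ι ι k) (u v : ι → k) : k := (fun i => u i ^ 2) ⬝ᵥ (A *ᵥ v)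

theorem frobForm_add_right (A : Matrix ι ι k) (u v w : ι → k) :
    frobForm A u (v + w) = frobForm A u v + frobForm A u w := by
  simp [frobForm, mulVec_add]

theorem frobForm_smul_right (A : Matrix ι ι k) (c : k) (u v : ι → k) :
    frobForm A u (c • v) = c * frobForm A u v := by
  simp [frobForm, mulVec_smul]

theorem frobForm_smul_left (A : Matrix ι ι k) (c : k) (u v : ι → k) :
    frobForm A (c • u) v = c ^ 2 * frobForm A u v := by
  have : (fun i => (c • u) i ^ 2) = c ^ 2 • fun i => u i ^ 2 := by
    ext i; simp [mul_pow]
  rw [frobForm, this, smul_dotProduct, smul_eq_mul, frobForm]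

theorem frobForm_add_left [CharP k 2] (A : Matrix ι ι k) (u v w : ι → k) :
    frobForm A (u + v) w = frobForm A u w + frobForm A v w := by
  have : (fun i => (u + v) i ^ 2) = (fun i => u i ^ 2) + fun i => v i ^ 2 := by
    ext i; simp [CharTwo.add_sq]
  rw [frobForm, this, add_dotProduct, frobForm, frobForm]

theorem frobForm_sum_right {κ : Type*} (s : Finset κ) (A : Matrix ι ι k) (u : ι → k)
    (v : κ → ι → k) : frobForm A u (∑ i ∈ s, v i) = ∑ i ∈ s, frobForm A u (v i) := by
  classical
  induction s using Finset.induction_on with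
  | empty => simp [frobForm]
  | insert i s hi ih => rw [Finset.sum_insert hi, Finset.sum_insert hi, frobForm_add_right, ih]

/-- A vector is rational if it satisfies `A(w, v) = A(v, w)²` for all `w`. The rational vectors form
a vector space over the field with four elements, and on it the form `A` is Hermitian. -/
def IsRational (A : Matrix ι ι k) (v : ι → k) : Prop :=
  ∀ w, frobForm A w v = frobForm A v w ^ 2

theorem IsRational.add [CharP k 2] {A : Matrix ι ι k} {u v : ι → k} (hu : IsRational A u)
    (hv : IsRational A v) : IsRational A (u + v) := by
  intro w
  rw [frobForm_add_right, frobForm_add_left, hu, hv, CharTwo.add_sq]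

theorem IsRational.smul {A : Matrix ι ι k} {v : ι → k} (hv : IsRational A v) {c : k}
    (hc : c ^ 4 = c) : IsRational A (c • v) := by
  intro w
  rw [frobForm_smul_right, frobForm_smul_left, hv]
  linear_combination - frobForm A v w ^ 2 * hc

theorem IsRational.sum [CharP k 2] {κ : Type*} {s : Finset κ} {A : Matrix ι ι k} {v : κ → ι → k}
    (hv : ∀ i ∈ s, IsRational A (v i)) : IsRational A (∑ i ∈ s, v i) := by
  classical
  induction s using Finset.induction_on with
  | empty => intro w; simp [frobForm]
  | insert i s hi ih =>
    rw [Finset.sum_insert hi]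
    exact (hv i (Finset.mem_insert_self _ _)).add
      (ih fun j hj => hv j (Finset.mem_insert_of_mem hj))

theorem IsRational.pow_four {A : Matrix ι ι k} {u v : ι → k} (hu : IsRational A u)
    (hv : IsRational A v) : frobForm A u v ^ 4 = frobForm A u v := by
  conv_rhs => rw [hv u, hu v]
  ring

theorem frobForm_left_nondegenerate [DecidableEq ι] {A : Matrix ι ι k} (hA : IsUnit A.det)
    {u : ι → k} (hu : ∀ v, frobForm A u v = 0) : u = 0 := by
  have h1 : (fun i => u i ^ 2) ᵥ* A = 0 := by
    apply dotProduct_eq_zero _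
    intro w
    rw [← dotProduct_mulVec]
    exact hu w
  have h2 := Matrix.eq_zero_of_vecMul_eq_zero hA.ne_zero h1
  ext i
  have := congrFun h2 i
  simpa using this

/-- The rational vectors are the fixed vectors of the semilinear bijection `ψ` with
`A(w, ψ v) = A(v, w)²`. -/
theorem span_isRational_eq_top [IsAlgClosed k] [CharP k 2] [DecidableEq ι] {A : Matrix ι ι k}
    (hA : IsUnit A.det) : Submodule.span k {v | IsRational A v} = ⊤ := by
  -- the semilinear map `ψ` with `A(v, ψ e) = A(e, v)²`
  let ψ : (ι → k) →+ (ι → k) := AddMonoidHom.mk'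
    (fun e => A⁻¹ *ᵥ fun i => frobForm A e (Pi.single i 1) ^ 2) fun u v => by
      rw [← mulVec_add]
      congr 1
      ext i
      rw [frobForm_add_left, CharTwo.add_sq]
      rfl
  have hψ : ∀ e v, frobForm A v (ψ e) = frobForm A e v ^ 2 := by
    intro e v
    have h1 : A *ᵥ ψ e = fun i => frobForm A e (Pi.single i 1) ^ 2 := by
      change A *ᵥ (A⁻¹ *ᵥ _) = _
      rw [mulVec_mulVec, mul_nonsing_inv _ hA, one_mulVec]
    have h2 : v = ∑ i, v i • (Pi.single i 1 : ι → k) := by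
      ext j; simp [Finset.sum_apply, Pi.single_apply]
    conv_rhs => rw [h2, frobForm_sum_right, CharTwo.sum_sq]
    rw [frobForm, h1, dotProduct]
    exact Finset.sum_congr rfl fun i _ => by rw [frobForm_smul_right, mul_pow]
  have hndr : ∀ u, (∀ v, frobForm A v u = 0) → u = 0 := by
    intro u hu
    refine Matrix.eq_zero_of_mulVec_eq_zero hA.ne_zero (M := A) ?_
    ext i
    have := hu (Pi.single i 1)
    have e : (fun j => (Pi.single i 1 : ι → k) j ^ 2) = Pi.single i 1 := by
      ext j
      by_cases h : j = i
      · subst h; simp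
      · simp [Pi.single_eq_of_ne h]
    rw [frobForm, e, single_dotProduct, one_mul] at this
    exact this
  have hsm : ∀ (c : k) v, ψ (c • v) = c ^ 4 • ψ v := by
    intro c v
    rw [← sub_eq_zero]
    refine hndr _ fun w => ?_
    rw [sub_eq_add_neg, ← neg_one_smul k, frobForm_add_right, frobForm_smul_right,
      frobForm_smul_right, hψ, hψ, frobForm_smul_left]
    ring
  have hinj : Function.Injective ψ := by
    rw [injective_iff_map_eq_zero]
    intro e he
    refine frobForm_left_nondegenerate hA fun v => ?_
    have := hψ e v
    rw [he] at this
    simpa [frobForm] using this.symm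
  rw [← span_fixed_eq_top ψ hsm hinj]
  congr 1
  ext v
  refine ⟨fun h => ?_, fun h w => ?_⟩
  · change ψ v = v
    rw [← sub_eq_zero]
    refine hndr _ fun w => ?_
    rw [sub_eq_add_neg, ← neg_one_smul k, frobForm_add_right, frobForm_smul_right, hψ, h w]
    ring
  · rw [← hψ, show ψ v = v from h]

end Hermitian

end CubicSurface

/-! ### Orthonormal bases and the Fermat equation -/

namespace CubicSurface

section Orthonormal

open Matrix

variable {k ι : Type*} [Field k] [Fintype ι]

/-- An orthonormal family of rational vectors that does not span extends by another vector. -/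
theorem exists_rational_unit_vector [IsAlgClosed k] [CharP k 2] [DecidableEq ι] {A : Matrix ι ι k}
    (hA : IsUnit A.det) {m : ℕ} (hm : m < Fintype.card ι) {e : Fin m → ι → k}
    (hrat : ∀ i, IsRational A (e i)) (he : ∀ i j, frobForm A (e i) (e j) = if i = j then 1 else 0) :
    ∃ v, IsRational A v ∧ frobForm A v v = 1 ∧ ∀ i, frobForm A (e i) v = 0 := by
  have two : (2 : k) = 0 := CharTwo.two_eq_zero
  -- the orthogonal projection to the complement of the family
  let proj : (ι → k) → ι → k := fun x => x + ∑ i, frobForm A (e i) x • e i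
  have hproj : ∀ x, IsRational A x →
      IsRational A (proj x) ∧ ∀ i, frobForm A (e i) (proj x) = 0 := by
    intro x hx
    refine ⟨hx.add (IsRational.sum fun i _ => (hrat i).smul ((hrat i).pow_four hx)), fun i => ?_⟩
    simp only [proj, frobForm_add_right, frobForm_sum_right, frobForm_smul_right, he]
    simp [CharTwo.add_self_eq_zero]
  by_contra! H
  have hvv : ∀ v, IsRational A v → (∀ i, frobForm A (e i) v = 0) → frobForm A v v = 0 := by
    intro v hv hev
    by_contra h0
    refine (H v hv ?_).elim fun i hi => hi (hev i)
    have h := hv v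
    exact (mul_left_cancel₀ h0 (by linear_combination -h) : frobForm A v v = 1)
  -- a generator of the field with four elements
  obtain ⟨ω, hω⟩ := exists_quintic_root (1 : k) 1 1 0 0 0 (by simp)
  have hω4 : ω ^ 4 = ω := by linear_combination (ω ^ 2 - ω) * hω
  -- the Hermitian form vanishes on the orthogonal complement of the family
  have huv : ∀ u v, IsRational A u → (∀ i, frobForm A (e i) u = 0) → IsRational A v →
      (∀ i, frobForm A (e i) v = 0) → frobForm A u v = 0 := by
    intro u v hu heu hv hev
    have key : ∀ u, IsRational A u → (∀ i, frobForm A (e i) u = 0) →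
        frobForm A u v + frobForm A u v ^ 2 = 0 := by
      intro u hu heu
      have h := hvv (u + v) (hu.add hv) fun i => by rw [frobForm_add_right, heu, hev, add_zero]
      rw [frobForm_add_left, frobForm_add_right, frobForm_add_right, hvv u hu heu, hvv v hv hev,
        hu v] at h
      linear_combination h
    have h1 := key u hu heu
    have h2 := key (ω • u) (hu.smul hω4) fun i => by rw [frobForm_smul_right, heu, mul_zero]
    rw [frobForm_smul_left] at h2
    linear_combination h2 - frobForm A u v ^ 2 * hω4 - ω * h1 + frobForm A u v * hω -
      ω ^ 2 * frobForm A u v * two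
  have hzero : ∀ u, IsRational A u → (∀ i, frobForm A (e i) u = 0) → u = 0 := by
    intro u hu heu
    refine frobForm_left_nondegenerate hA fun v => ?_
    have hv : v ∈ Submodule.span k {v | IsRational A v} := by
      rw [span_isRational_eq_top hA]; trivial
    induction hv using Submodule.span_induction with
    | mem x hx =>
      have hue : ∀ i, frobForm A u (e i) = 0 := fun i => by rw [hrat i u, heu, zero_pow two_ne_zero]
      have h := huv u (proj x) hu heu (hproj x hx).1 (hproj x hx).2
      simpa [proj, frobForm_add_right, frobForm_sum_right, frobForm_smul_right, hue] using h
    | zero => simp [frobForm]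
    | add x y _ _ hx hy => rw [frobForm_add_right, hx, hy, add_zero]
    | smul c x _ hx => rw [frobForm_smul_right, hx, mul_zero]
  have hle : (⊤ : Submodule k (ι → k)) ≤ Submodule.span k (Set.range e) := by
    rw [← span_isRational_eq_top hA, Submodule.span_le]
    intro x hx
    have h := hzero _ (hproj x hx).1 (hproj x hx).2
    have hx' : x = - ∑ i, frobForm A (e i) x • e i := eq_neg_of_add_eq_zero_left h
    rw [hx']
    exact Submodule.neg_mem _ (Submodule.sum_mem _ fun i _ =>
      Submodule.smul_mem _ _ (Submodule.subset_span ⟨i, rfl⟩))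
  have h1 := finrank_range_le_card (R := k) e
  rw [Set.finrank, top_le_iff.mp hle, finrank_top, Module.finrank_fintype_fun_eq_card,
    Fintype.card_fin] at h1
  omega

/-- A nondegenerate form `∑ aᵢⱼ uᵢ² vⱼ` over an algebraically closed field of characteristic two has
an orthonormal basis. -/
theorem exists_orthonormal [IsAlgClosed k] [CharP k 2] [DecidableEq ι] {A : Matrix ι ι k}
    (hA : IsUnit A.det) (m : ℕ) (hm : m ≤ Fintype.card ι) : ∃ e : Fin m → ι → k,
      (∀ i, IsRational A (e i)) ∧ ∀ i j, frobForm A (e i) (e j) = if i = j then 1 else 0 := by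
  induction m with
  | zero => exact ⟨Fin.elim0, fun i => i.elim0, fun i => i.elim0⟩
  | succ m ih =>
    obtain ⟨e, hrat, he⟩ := ih (by omega)
    obtain ⟨v, hv, hvv, hev⟩ := exists_rational_unit_vector hA (by omega) hrat he
    refine ⟨Fin.snoc e v, fun i => ?_, fun i j => ?_⟩
    · refine Fin.lastCases ?_ (fun j => ?_) i
      · simpa using hv
      · simpa using hrat j
    · refine Fin.lastCases ?_ (fun i => ?_) i <;> refine Fin.lastCases ?_ (fun j => ?_) j
      · simpa using hvv
      · simp [(hrat j) v, hev j, (Fin.castSucc_lt_last j).ne']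
      · simp [hev i, (Fin.castSucc_lt_last i).ne]
      · simp [he i j]

end Orthonormal

variable {k : Type u} [Field k]

theorem cubicPolar_D_eq_frobForm [CharP k 2] (a : Fin 4 → Fin 4 → k) (u v : Fin 4 → k) :
    (cubicPolar a 0).D u v = frobForm (Matrix.of a) u v := by
  change cubicDifferential a 0 u v = _
  rw [cubicDifferential_apply, frobForm]
  simp [dotProduct, Matrix.mulVec, Finset.mul_sum]
  exact Finset.sum_congr rfl fun _ _ => Finset.sum_congr rfl fun _ _ => by ring

/-- A vector `w` with `w A = 0` gives the singular point `u` with `uᵢ² = wᵢ`. -/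
theorem IsSmooth.isUnit_det [IsAlgClosed k] [CharP k 2] {a : Fin 4 → Fin 4 → k}
    (h : IsSmooth (cubicForm a 0)) : IsUnit (Matrix.of a).det := by
  rw [isUnit_iff_ne_zero]
  intro h0
  obtain ⟨w, hw, hwa⟩ := Matrix.exists_vecMul_eq_zero_iff.mpr h0
  have hr : ∀ i, ∃ u, u ^ 2 = w i := fun i => IsAlgClosed.exists_pow_nat_eq (w i) (by norm_num)
  choose u hu using hr
  have hu0 : u ≠ 0 := by
    rintro rfl
    apply hw
    ext i
    rw [← hu i]; simp
  obtain ⟨v, hv⟩ := h.exists_D_ne_zero u hu0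
  apply hv
  rw [cubicPolar_D_eq_frobForm, frobForm, Matrix.dotProduct_mulVec]
  have : (fun i => u i ^ 2) = w := funext hu
  rw [this, hwa, zero_dotProduct]

theorem eval_fermat (v : Fin 4 → k) : MvPolynomial.eval v (fermat k) = ∑ i, v i ^ 3 := by
  simp [fermat]

/-- A smooth cubic surface with zero pole is projectively equivalent to the Fermat surface. -/
theorem IsSmooth.exists_aeval_eq_fermat [IsAlgClosed k] [CharP k 2] {a : Fin 4 → Fin 4 → k}
    (h : IsSmooth (cubicForm a 0)) : ∃ P : GL (Fin 4) k,
      MvPolynomial.aeval (fun i => ∑ j, MvPolynomial.C ((P : Matrix (Fin 4) (Fin 4) k) i j) *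
        MvPolynomial.X j) (cubicForm a 0) = fermat k := by
  obtain ⟨e, -, he⟩ := exists_orthonormal h.isUnit_det 4 (by simp)
  let M : Matrix (Fin 4) (Fin 4) k := Matrix.of fun i j => e j i
  have hM : ∀ y, M.mulVec y = ∑ j, y j • e j := by
    intro y
    ext i
    simp [M, Matrix.mulVec, dotProduct, mul_comm]
  have hcomb : ∀ y w, frobForm (Matrix.of a) (M.mulVec y) w =
      ∑ j, y j ^ 2 * frobForm (Matrix.of a) (e j) w := by
    intro y w
    rw [hM]
    simp [Fin.sum_univ_four, frobForm_add_left, frobForm_smul_left]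
  have hcomb' : ∀ u y, frobForm (Matrix.of a) u (M.mulVec y) =
      ∑ j, y j * frobForm (Matrix.of a) u (e j) := by
    intro u y
    rw [hM, frobForm_sum_right]
    simp [frobForm_smul_right]
  have hdet : IsUnit M.det := by
    rw [isUnit_iff_ne_zero]
    intro h0
    obtain ⟨y, hy, hMy⟩ := Matrix.exists_mulVec_eq_zero_iff.mpr h0
    apply hy
    ext i
    have := hcomb' (e i) y
    have h0' : frobForm (Matrix.of a) (e i) 0 = 0 := by simp [frobForm]
    rw [hMy, h0'] at this
    simpa [he] using this.symm
  refine ⟨Matrix.GeneralLinearGroup.mkOfDetNeZero M hdet.ne_zero, MvPolynomial.funext fun y => ?_⟩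
  have h1 : MvPolynomial.eval y (MvPolynomial.aeval (fun i => ∑ j,
      MvPolynomial.C (M i j) * MvPolynomial.X j) (cubicForm a 0)) =
      MvPolynomial.eval (M.mulVec y) (cubicForm a 0) := by
    rw [← MvPolynomial.coe_aeval_eq_eval, ← MvPolynomial.coe_aeval_eq_eval]
    change ((MvPolynomial.aeval y).comp (MvPolynomial.aeval _)) _ = _
    have hy : (fun i => MvPolynomial.aeval y (∑ j, MvPolynomial.C (M i j) * MvPolynomial.X j)) =
        M.mulVec y := by
      ext i
      simp [Matrix.mulVec, dotProduct]
    rw [MvPolynomial.comp_aeval, hy]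
    rfl
  refine h1.trans ?_
  rw [eval_cubicForm, cubicPolar_D_eq_frobForm, hcomb, eval_fermat]
  refine Finset.sum_congr rfl fun i _ => ?_
  rw [hcomb']
  simp [he]
  ring

end CubicSurface

/-! ### Triangles and their absence -/

namespace CubicSurface

variable {k : Type u} [Field k]

/-- On a line `B(u, u)` vanishes identically, and the coefficients of `s²` and `s` in
`B(s u + v, s u + v)` are `B(u, v)` and `B(v, u)`. -/
theorem IsLineOn.frobForm_eq_zero [IsAlgClosed k] [CharP k 2] {a : Fin 4 → Fin 4 → k}
    {L : Submodule k (Fin 4 → k)} (hL : IsLineOn (cubicForm a 0) L) {u v : Fin 4 → k}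
    (hu : u ∈ L) (hv : v ∈ L) : frobForm (Matrix.of a) u v = 0 := by
  have hself : ∀ w ∈ L, frobForm (Matrix.of a) w w = 0 := fun w hw => by
    rw [← cubicPolar_D_eq_frobForm, ← eval_cubicForm, hL.2 w hw]
  have h : ∀ s : k, s ^ 2 * frobForm (Matrix.of a) u v + s * frobForm (Matrix.of a) v u = 0 := by
    intro s
    have h := hself (s • u + v) (L.add_mem (L.smul_mem s hu) hv)
    have h1 := hself (s • u) (L.smul_mem s hu)
    rw [frobForm_add_left, frobForm_add_right, frobForm_add_right, h1, hself v hv,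
      frobForm_smul_left, frobForm_smul_right] at h
    linear_combination h
  obtain ⟨ω, hω⟩ := exists_quintic_root (1 : k) 1 1 0 0 0 (by simp)
  have h1 := h 1
  have h2 := h ω
  linear_combination frobForm (Matrix.of a) u v * hω + ω * h1 - h2 -
    frobForm (Matrix.of a) u v * ω * (CharTwo.two_eq_zero : (2 : k) = 0)

theorem exists_mem_inf_of_coplanar {V : Type*} [AddCommGroup V] [Module k V]
    [FiniteDimensional k V] {H L M : Submodule k V} (hH : Module.finrank k H = 3)
    (hL : Module.finrank k L = 2) (hM : Module.finrank k M = 2) (hLH : L ≤ H) (hMH : M ≤ H)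
    (hne : L ≠ M) : L ⊔ M = H ∧ ∃ p, p ≠ 0 ∧ p ∈ L ∧ p ∈ M := by
  have hlt : L < L ⊔ M := by
    refine lt_of_le_of_ne le_sup_left fun h => hne ?_
    exact (Submodule.eq_of_le_of_finrank_eq (sup_eq_left.mp h.symm) (hM.trans hL.symm)).symm
  have h1 := Submodule.finrank_lt_finrank_of_lt hlt
  have h2 := Submodule.finrank_mono (sup_le hLH hMH)
  have h3 := Submodule.finrank_sup_add_finrank_inf_eq L M
  refine ⟨Submodule.eq_of_le_of_finrank_le (sup_le hLH hMH) (by omega), ?_⟩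
  have h4 : L ⊓ M ≠ ⊥ := by
    intro h
    rw [h, finrank_bot] at h3
    omega
  obtain ⟨p, hp, hp0⟩ := Submodule.exists_mem_ne_zero_of_ne_bot h4
  exact ⟨p, hp0, hp.1, hp.2⟩

/-- A smooth cubic surface with zero pole is triangle-free: a point where two lines of a plane `H`
meet is in the kernel of the form restricted to `H`, and two different such points would give a
singular point on the line through them. -/
theorem IsSmooth.isTriangleFree [IsAlgClosed k] [CharP k 2] {a : Fin 4 → Fin 4 → k}
    (h : IsSmooth (cubicForm a 0)) : IsTriangleFree (cubicForm a 0) := by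
  rintro S hS ⟨H, hH, hSH⟩
  by_cases hsub : S.Subsingleton
  · obtain rfl | ⟨L, rfl⟩ := hsub.eq_empty_or_singleton
    · exact ⟨Pi.single 0 1, by simp, by simp⟩
    · have hL : L ≠ ⊥ := by
        rintro rfl
        simpa using (hS _ rfl).1
      obtain ⟨p, hp, hp0⟩ := Submodule.exists_mem_ne_zero_of_ne_bot hL
      exact ⟨p, hp0, by simpa using hp⟩
  obtain ⟨L₁, h₁, L₂, h₂, hne⟩ := Set.not_subsingleton_iff.mp hsub
  -- a common point of two of the lines is in the kernel of the form on `H`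
  have hker : ∀ L ∈ S, ∀ M ∈ S, L ≠ M → ∃ p, p ≠ 0 ∧ p ∈ L ∧ p ∈ M ∧
      ∀ w ∈ H, frobForm (Matrix.of a) p w = 0 := by
    intro L hL M hM hLM
    obtain ⟨hsup, p, hp0, hpL, hpM⟩ := exists_mem_inf_of_coplanar hH (hS L hL).1 (hS M hM).1
      (hSH L hL) (hSH M hM) hLM
    refine ⟨p, hp0, hpL, hpM, fun w hw => ?_⟩
    rw [← hsup] at hw
    obtain ⟨x, hx, y, hy, rfl⟩ := Submodule.mem_sup.mp hw
    rw [frobForm_add_right, (hS L hL).frobForm_eq_zero hpL hx, (hS M hM).frobForm_eq_zero hpM hy,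
      add_zero]
  obtain ⟨p, hp0, hp₁, hp₂, hpH⟩ := hker L₁ h₁ L₂ h₂ hne
  refine ⟨p, hp0, fun L₃ h₃ => ?_⟩
  by_contra hp₃
  obtain ⟨q, hq0, -, hq₃, hqH⟩ := hker L₁ h₁ L₃ h₃ fun h => hp₃ (h ▸ hp₁)
  obtain ⟨w, hw⟩ : ∃ w, w ∉ H := by
    by_contra! hall
    rw [(Submodule.eq_top_iff'.mpr hall), finrank_top] at hH
    simp at hH
  -- a combination of the two points is orthogonal to `w` as well
  obtain ⟨α, hα⟩ := IsAlgClosed.exists_pow_nat_eq (frobForm (Matrix.of a) q w) (n := 2)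
    (by norm_num)
  obtain ⟨β, hβ⟩ := IsAlgClosed.exists_pow_nat_eq (frobForm (Matrix.of a) p w) (n := 2)
    (by norm_num)
  have key : ∀ v, v ≠ 0 → (∀ x ∈ H, frobForm (Matrix.of a) v x = 0) →
      frobForm (Matrix.of a) v w ≠ 0 := by
    intro v hv hvH hvw
    refine hv (frobForm_left_nondegenerate h.isUnit_det fun x => ?_)
    have hx : x ∈ H ⊔ Submodule.span k {w} := by
      have hlt : H < H ⊔ Submodule.span k {w} := by
        refine lt_of_le_of_ne le_sup_left fun h => hw ?_
        rw [h]
        exact Submodule.mem_sup_right (Submodule.mem_span_singleton_self w)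
      have h1 := Submodule.finrank_lt_finrank_of_lt hlt
      rw [Submodule.eq_top_of_finrank_eq (S := H ⊔ Submodule.span k {w})]
      · trivial
      · have h2 := Submodule.finrank_le (H ⊔ Submodule.span k {w})
        simp at h2 ⊢
        omega
    obtain ⟨y, hy, z, hz, rfl⟩ := Submodule.mem_sup.mp hx
    obtain ⟨c, rfl⟩ := Submodule.mem_span_singleton.mp hz
    rw [frobForm_add_right, frobForm_smul_right, hvH y hy, hvw, mul_zero, add_zero]
  have hα0 : α ≠ 0 := by
    rintro rfl
    exact key q hq0 hqH (by rw [← hα]; simp)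
  refine key (α • p + β • q) ?_ (fun x hx => ?_) ?_
  · intro h0
    refine hp₃ ?_
    have : p = α⁻¹ • (-(β • q)) := by
      rw [← eq_neg_of_add_eq_zero_left h0, smul_smul, inv_mul_cancel₀ hα0, one_smul]
    rw [this]
    exact L₃.smul_mem _ (L₃.neg_mem (L₃.smul_mem _ hq₃))
  · rw [frobForm_add_left, frobForm_smul_left, frobForm_smul_left, hpH x hx, hqH x hx]
    simp
  · rw [frobForm_add_left, frobForm_smul_left, frobForm_smul_left, hα, hβ]
    linear_combination frobForm (Matrix.of a) p w * frobForm (Matrix.of a) q w *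
      (CharTwo.two_eq_zero : (2 : k) = 0)

theorem IsSmooth.smooth_cubicPolar [CharP k 2] {a : Fin 4 → Fin 4 → k}
    {t : Fin 4 → k} (h : IsSmooth (cubicForm a t)) : (cubicPolar a t).Smooth :=
  fun u hu => h.exists_D_ne_zero u hu

/-- A smooth cubic surface with a pole contains three lines of a plane without a common point. -/
theorem IsSmooth.not_isTriangleFree [IsAlgClosed k] [CharP k 2] {a : Fin 4 → Fin 4 → k}
    {t : Fin 4 → k} (ht : t ≠ 0) (h : IsSmooth (cubicForm a t)) :
    ¬ IsTriangleFree (cubicForm a t) := by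
  obtain ⟨u, v, q, hli, huv, huq, hvq⟩ :=
    h.smooth_cubicPolar.exists_triangle_of_pole_ne_zero (by simp) ht
  have hcomb : ∀ x y z : k, x • u + y • v + z • q = 0 → x = 0 ∧ y = 0 ∧ z = 0 := by
    intro x y z hxyz
    have := Fintype.linearIndependent_iff.mp hli ![x, y, z]
      (by simpa [Fin.sum_univ_three] using hxyz)
    exact ⟨this 0, this 1, this 2⟩
  have line : ∀ x y, LinearIndependent k ![x, y] → (cubicPolar a t).Isotropic x y →
      IsLineOn (cubicForm a t) (Submodule.span k {x, y}) :=
    fun x y hxy hI => isLineOn_span_pair hxy hI.1 hI.2.1 hI.2.2.1 hI.2.2.2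
  intro htf
  obtain ⟨p, hp0, hp⟩ := htf {Submodule.span k {u, v}, Submodule.span k {u, q},
      Submodule.span k {v, q}} (by
    rintro L (rfl | rfl | rfl)
    · refine line u v (LinearIndependent.pair_iff.mpr fun x y hxy => ?_) huv
      have := hcomb x y 0 (by simpa using hxy)
      exact ⟨this.1, this.2.1⟩
    · refine line u q (LinearIndependent.pair_iff.mpr fun x y hxy => ?_) huq
      have := hcomb x 0 y (by simpa using hxy)
      exact ⟨this.1, this.2.2⟩
    · refine line v q (LinearIndependent.pair_iff.mpr fun x y hxy => ?_) hvq
      have := hcomb 0 x y (by simpa using hxy)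
      exact ⟨this.2.1, this.2.2⟩) (by
    refine ⟨Submodule.span k (Set.range ![u, v, q]), by
      rw [finrank_span_eq_card hli, Fintype.card_fin], ?_⟩
    rintro L (rfl | rfl | rfl) <;> refine Submodule.span_mono ?_ <;>
      simp [Set.insert_subset_iff])
  obtain ⟨a₁, b₁, h₁⟩ := Submodule.mem_span_pair.mp (hp _ (Or.inl rfl))
  obtain ⟨a₂, b₂, h₂⟩ := Submodule.mem_span_pair.mp (hp _ (Or.inr (Or.inl rfl)))
  obtain ⟨a₃, b₃, h₃⟩ := Submodule.mem_span_pair.mp (hp _ (Or.inr (Or.inr rfl)))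
  have e₁ := hcomb (a₁ - a₂) b₁ (-b₂) (by
    have : (a₁ - a₂) • u + b₁ • v + -b₂ • q = a₁ • u + b₁ • v - (a₂ • u + b₂ • q) := by
      rw [sub_smul, neg_smul]; abel
    rw [this, h₁, h₂, sub_self])
  have e₂ := hcomb a₁ (b₁ - a₃) (-b₃) (by
    have : a₁ • u + (b₁ - a₃) • v + -b₃ • q = a₁ • u + b₁ • v - (a₃ • v + b₃ • q) := by
      rw [sub_smul, neg_smul]; abel
    rw [this, h₁, h₃, sub_self])
  refine hp0 ?_
  rw [← h₁, e₂.1, e₁.2.1]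
  simp

end CubicSurface

/-! ### The Fermat surface is not Frobenius split -/

namespace CubicSurface

section Proj

open HomogeneousLocalization CategoryTheory

variable {k A : Type u} [CommRing k] [CommRing A] [Algebra k A] {𝒜 : ℕ → Submodule k A}
  [GradedAlgebra 𝒜]

theorem exists_away_equiv {f : A} {m : ℕ} (hf : f ∈ 𝒜 m) (hm : 0 < m) :
    ∃ e : Away 𝒜 f ≃+* Γ(Proj 𝒜, Proj.basicOpen 𝒜 f),
      ∀ a, e a = (Proj.awayToSection 𝒜 f).hom a :=
  ⟨(Proj.basicOpenIsoAway 𝒜 f hf hm).commRingCatIsoToRingEquiv, fun _ => rfl⟩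

theorem awayToSection_awayMap {f g x : A} {n : ℕ} (hg : g ∈ 𝒜 n) (hx : x = f * g)
    (a : Away 𝒜 f) :
    (Proj.awayToSection 𝒜 x).hom (awayMap 𝒜 hg hx a) = ((Proj 𝒜).presheaf.map
      (homOfLE (Proj.basicOpen_mono 𝒜 f x ⟨_, hx⟩)).op).hom ((Proj.awayToSection 𝒜 f).hom a) := by
  have h := congrArg CommRingCat.Hom.hom (Proj.awayMap_awayToSection 𝒜 hg hx)
  rw [CommRingCat.hom_comp, CommRingCat.hom_comp, CommRingCat.hom_ofHom] at h
  exact RingHom.congr_fun h a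

/-- On the two standard affine opens of `Proj` given by linear forms `f` and `g`, and on their
intersection, a Frobenius splitting is a compatible family of maps of the rings of degree zero
fractions. -/
theorem IsFrobeniusSplit.exists_away (h : IsFrobeniusSplit 2 (Proj 𝒜)) {f g x : A} {m n : ℕ}
    (hf : f ∈ 𝒜 m) (hg : g ∈ 𝒜 n) (hm : 0 < m) (hn : 0 < n) (hx : x = f * g) (hx' : x = g * f) :
    ∃ (φ₁ : Away 𝒜 f → Away 𝒜 f) (φ₂ : Away 𝒜 g → Away 𝒜 g) (φ : Away 𝒜 x →+ Away 𝒜 x),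
      (∀ a, φ (awayMap 𝒜 hg hx a) = awayMap 𝒜 hg hx (φ₁ a)) ∧
      (∀ a, φ (awayMap 𝒜 hf hx' a) = awayMap 𝒜 hf hx' (φ₂ a)) ∧
      (∀ a b, φ (a ^ 2 * b) = a * φ b) ∧ ∀ a, φ (a ^ 2) = a := by
  obtain ⟨φ, hres, hmul, hsq⟩ := h
  have hxm : x ∈ 𝒜 (m + n) := hx ▸ SetLike.mul_mem_graded hf hg
  obtain ⟨e₁, he₁⟩ := exists_away_equiv hf hm
  obtain ⟨e₂, he₂⟩ := exists_away_equiv hg hn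
  obtain ⟨e, he⟩ := exists_away_equiv hxm (by omega)
  have hr₁ : ∀ a, e (awayMap 𝒜 hg hx a) = ((Proj 𝒜).presheaf.map
      (homOfLE (Proj.basicOpen_mono 𝒜 f x ⟨_, hx⟩)).op).hom (e₁ a) := fun a => by
    rw [he, he₁, awayToSection_awayMap]
  have hr₂ : ∀ a, e (awayMap 𝒜 hf hx' a) = ((Proj 𝒜).presheaf.map
      (homOfLE (Proj.basicOpen_mono 𝒜 g x ⟨_, hx'⟩)).op).hom (e₂ a) := fun a => by
    rw [he, he₂, awayToSection_awayMap]
  have hres₁ : ∀ a, φ _ (((Proj 𝒜).presheaf.map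
      (homOfLE (Proj.basicOpen_mono 𝒜 f x ⟨_, hx⟩)).op).hom a) = ((Proj 𝒜).presheaf.map
      (homOfLE (Proj.basicOpen_mono 𝒜 f x ⟨_, hx⟩)).op).hom (φ _ a) := fun a => hres _ _ _ a
  have hres₂ : ∀ a, φ _ (((Proj 𝒜).presheaf.map
      (homOfLE (Proj.basicOpen_mono 𝒜 g x ⟨_, hx'⟩)).op).hom a) = ((Proj 𝒜).presheaf.map
      (homOfLE (Proj.basicOpen_mono 𝒜 g x ⟨_, hx'⟩)).op).hom (φ _ a) := fun a => hres _ _ _ a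
  refine ⟨fun a => e₁.symm (φ _ (e₁ a)), fun a => e₂.symm (φ _ (e₂ a)),
    AddMonoidHom.mk' (fun a => e.symm (φ _ (e a))) (fun a b => by simp only [map_add]),
    fun a => ?_, fun a => ?_, fun a b => ?_, fun a => ?_⟩
  · rw [AddMonoidHom.mk'_apply, RingEquiv.symm_apply_eq, hr₁, hr₁, hres₁,
      RingEquiv.apply_symm_apply]
  · rw [AddMonoidHom.mk'_apply, RingEquiv.symm_apply_eq, hr₂, hr₂, hres₂,
      RingEquiv.apply_symm_apply]
  · rw [AddMonoidHom.mk'_apply, RingEquiv.symm_apply_eq, map_mul e,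
      map_mul e, map_pow e, hmul, RingEquiv.apply_symm_apply]
  · rw [AddMonoidHom.mk'_apply, RingEquiv.symm_apply_eq, map_pow, hsq]

/-- If `l₀³ + l₁³ + l₂³ + l₃³ = 0`, then the square of `e = l₃² / (l₁ l₂)` is
`(l₀ / l₁)² (l₀ l₃ / l₂²) + l₁ l₃ / l₂² + l₂ l₃ / l₁²`. Hence a splitting, applied to `e²`, writes
`e` modulo `l₀` as a sum of functions that are regular where `l₂`, respectively `l₁`, is nonzero. -/
theorem IsFrobeniusSplit.exists_eq_add (h : IsFrobeniusSplit 2 (Proj 𝒜)) (two : (2 : A) = 0)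
    {l : Fin 4 → A} (hl : ∀ i, l i ∈ 𝒜 1) (hsum : ∑ i, l i ^ 3 = 0) :
    ∃ (N : ℕ) (x y z : A),
      l 3 ^ 2 * (l 1 * l 2) ^ N = l 0 * x + l 1 ^ (N + 1) * y + l 2 ^ (N + 1) * z := by
  have hx : l 1 * l 2 = l 1 * l 2 := rfl
  have hx' : l 1 * l 2 = l 2 * l 1 := mul_comm _ _
  have hxm : l 1 * l 2 ∈ 𝒜 (1 + 1) := SetLike.mul_mem_graded (hl 1) (hl 2)
  have hll : ∀ i j, l i * l j ∈ 𝒜 (1 + 1) := fun i j => SetLike.mul_mem_graded (hl i) (hl j)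
  obtain ⟨φ₁, φ₂, φ, hφ₁, hφ₂, hmul, hsq⟩ := h.exists_away (hl 1) (hl 2) one_pos one_pos hx hx'
  let ι := algebraMap A (Localization.Away (l 1 * l 2))
  have hu : IsUnit (ι (l 1 * l 2)) := IsLocalization.Away.algebraMap_isUnit _
  have hval : ∀ (n : ℕ) (a : A) (ha), (Away.mk 𝒜 hxm n a ha).val * ι (l 1 * l 2) ^ n = ι a := by
    intro n a ha
    rw [Away.val_mk, ← map_pow, Localization.mk_eq_mk']
    exact IsLocalization.mk'_spec _ _ _
  let e : Away 𝒜 (l 1 * l 2) := Away.mk 𝒜 hxm 1 (l 3 * l 3) (by simpa using hll 3 3)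
  let α := Away.mk 𝒜 (hl 1) 1 (l 0) (by simpa using hl 0)
  let β := Away.mk 𝒜 (hl 2) 2 (l 0 * l 3) (by simpa using hll 0 3)
  let γ := Away.mk 𝒜 (hl 2) 2 (l 1 * l 3) (by simpa using hll 1 3)
  let δ := Away.mk 𝒜 (hl 1) 2 (l 2 * l 3) (by simpa using hll 2 3)
  have hsum' : ι (l 0) ^ 3 + ι (l 1) ^ 3 + ι (l 2) ^ 3 + ι (l 3) ^ 3 = 0 := by
    have := congrArg ι hsum
    simpa [Fin.sum_univ_four] using this
  have two' : (2 : Localization.Away (l 1 * l 2)) = 0 := by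
    have := congrArg ι two
    rwa [map_ofNat, map_zero] at this
  have he := hval 1 (l 3 * l 3) (by simpa using hll 3 3)
  have hα : (awayMap 𝒜 (hl 2) hx α).val * ι (l 1 * l 2) ^ 1 = ι (l 0 * l 2 ^ 1) := by
    rw [awayMap_mk]; exact hval _ _ _
  have hβ : (awayMap 𝒜 (hl 1) hx' β).val * ι (l 1 * l 2) ^ 2 = ι (l 0 * l 3 * l 1 ^ 2) := by
    rw [awayMap_mk]; exact hval _ _ _
  have hγ : (awayMap 𝒜 (hl 1) hx' γ).val * ι (l 1 * l 2) ^ 2 = ι (l 1 * l 3 * l 1 ^ 2) := by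
    rw [awayMap_mk]; exact hval _ _ _
  have hδ : (awayMap 𝒜 (hl 2) hx δ).val * ι (l 1 * l 2) ^ 2 = ι (l 2 * l 3 * l 2 ^ 2) := by
    rw [awayMap_mk]; exact hval _ _ _
  have hesq : e ^ 2 = (awayMap 𝒜 (hl 2) hx α) ^ 2 * awayMap 𝒜 (hl 1) hx' β +
      awayMap 𝒜 (hl 1) hx' γ + awayMap 𝒜 (hl 2) hx δ := by
    apply val_injective
    rw [val_add, val_add, val_mul, val_pow, val_pow]
    apply (hu.pow 4).mul_left_injective
    change e.val * _ = _ at he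
    dsimp only
    generalize e.val = E at *
    generalize (awayMap 𝒜 (hl 2) hx α).val = a at *
    generalize (awayMap 𝒜 (hl 1) hx' β).val = b at *
    generalize (awayMap 𝒜 (hl 1) hx' γ).val = c at *
    generalize (awayMap 𝒜 (hl 2) hx δ).val = d at *
    simp only [map_mul, map_pow] at he hα hβ hγ hδ ⊢
    linear_combination (ι (l 1) * ι (l 2)) ^ 2 * (E * (ι (l 1) * ι (l 2)) + ι (l 3) ^ 2) * he -
      a ^ 2 * (ι (l 1) * ι (l 2)) ^ 2 * hβ - ι (l 0) * ι (l 3) * ι (l 1) ^ 2 *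
      (a * (ι (l 1) * ι (l 2)) + ι (l 0) * ι (l 2)) * hα - (ι (l 1) * ι (l 2)) ^ 2 * (hγ + hδ) +
      ι (l 3) * (ι (l 1) * ι (l 2)) ^ 2 * (hsum' - (ι (l 0) ^ 3 + ι (l 1) ^ 3 + ι (l 2) ^ 3) * two')
  have heq : e = awayMap 𝒜 (hl 2) hx α * awayMap 𝒜 (hl 1) hx' (φ₂ β) +
      awayMap 𝒜 (hl 1) hx' (φ₂ γ) + awayMap 𝒜 (hl 2) hx (φ₁ δ) := by
    rw [← hsq e, hesq, map_add, map_add, hmul, hφ₂, hφ₂, hφ₁]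
  obtain ⟨n, b, hb, hb'⟩ := Away.mk_surjective 𝒜 (hl 2) (φ₂ β)
  obtain ⟨m, c, hc, hc'⟩ := Away.mk_surjective 𝒜 (hl 2) (φ₂ γ)
  obtain ⟨r, d, hd, hd'⟩ := Away.mk_surjective 𝒜 (hl 1) (φ₁ δ)
  have hβ₂ : (awayMap 𝒜 (hl 1) hx' (φ₂ β)).val * ι (l 1 * l 2) ^ n = ι (b * l 1 ^ n) := by
    rw [← hb', awayMap_mk]; exact hval _ _ _
  have hγ₂ : (awayMap 𝒜 (hl 1) hx' (φ₂ γ)).val * ι (l 1 * l 2) ^ m = ι (c * l 1 ^ m) := by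
    rw [← hc', awayMap_mk]; exact hval _ _ _
  have hδ₂ : (awayMap 𝒜 (hl 2) hx (φ₁ δ)).val * ι (l 1 * l 2) ^ r = ι (d * l 2 ^ r) := by
    rw [← hd', awayMap_mk]; exact hval _ _ _
  have heq' := congrArg val heq
  rw [val_add, val_add, val_mul] at heq'
  have hι : ι (l 3 ^ 2 * (l 1 * l 2) ^ (n + m + r)) =
      ι (l 0 * l 2 * b * l 1 ^ n * (l 1 * l 2) ^ (m + r) +
        c * l 1 ^ m * (l 1 * l 2) ^ (n + r + 1) + d * l 2 ^ r * (l 1 * l 2) ^ (n + m + 1)) := by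
    change e.val * _ = _ at he
    generalize e.val = E at *
    generalize (awayMap 𝒜 (hl 2) hx α).val = a at *
    generalize (awayMap 𝒜 (hl 1) hx' (φ₂ β)).val = b' at *
    generalize (awayMap 𝒜 (hl 1) hx' (φ₂ γ)).val = c' at *
    generalize (awayMap 𝒜 (hl 2) hx (φ₁ δ)).val = d' at *
    simp only [map_mul, map_pow, map_add] at he hα hβ₂ hγ₂ hδ₂ ⊢
    generalize ι (l 1) * ι (l 2) = X at *
    linear_combination -X ^ (n + m + r) * he + X ^ (n + m + r + 1) * heq' +
      b' * X ^ (n + m + r) * hα + ι (l 0) * ι (l 2) * X ^ (m + r) * hβ₂ +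
      X ^ (n + r + 1) * hγ₂ + X ^ (n + m + 1) * hδ₂
  obtain ⟨⟨_, K, rfl⟩, hK⟩ := IsLocalization.exists_of_eq (M := Submonoid.powers (l 1 * l 2)) hι
  refine ⟨n + m + r + K, l 2 * b * l 1 ^ n * (l 1 * l 2) ^ (m + r + K),
    c * l 2 ^ (n + r + 1 + K), d * l 1 ^ (n + m + 1 + K), ?_⟩
  dsimp only at hK
  linear_combination hK

end Proj

open Polynomial in
/-- A ring embeds into one where a monic polynomial has a root whose powers, below the degree of the
polynomial, are linearly independent. -/
theorem exists_root_extension {R : Type u} [CommRing R] {g : R[X]} (hg : g.Monic) :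
    ∃ (S : Type u) (_ : CommRing S) (φ : R →+* S) (r : S), eval₂ φ r g = 0 ∧
      ∀ j < g.natDegree, ∀ c, φ c * r ^ j = 0 → c = 0 := by
  refine ⟨AdjoinRoot g, inferInstance, AdjoinRoot.of g, AdjoinRoot.root g, AdjoinRoot.eval₂_root g,
    fun j hj c h => ?_⟩
  by_contra hc
  have h' : AdjoinRoot.mk g (C c * X ^ j) = 0 := by
    rw [map_mul, map_pow, AdjoinRoot.mk_C, AdjoinRoot.mk_X, h]
  rw [AdjoinRoot.mk_eq_zero] at h'
  refine hg.not_dvd_of_natDegree_lt ?_ ?_ h'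
  · intro h0
    apply hc
    simpa using congrArg (fun p => coeff p j) h0
  · exact (natDegree_C_mul_X_pow_le c j).trans_lt hj

open Polynomial in
/-- There is an algebra with elements `s`, `t`, `z` such that `s ^ (N + 1)`, `t ^ (N + 1)` and
`s³ + t³ + z³` vanish, but `z² (s t) ^ N` does not. -/
theorem exists_fermat_algebra (k : Type u) [Field k] (N : ℕ) :
    ∃ (R : Type u) (_ : CommRing R) (_ : Algebra k R) (s t z : R), s ^ (N + 1) = 0 ∧
      t ^ (N + 1) = 0 ∧ s ^ 3 + t ^ 3 + z ^ 3 = 0 ∧ z ^ 2 * (s * t) ^ N ≠ 0 := by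
  have hdeg : ∀ {R : Type u} [CommRing R] [Nontrivial R], N < (X ^ (N + 1) : R[X]).natDegree := by
    intro R _ _
    rw [natDegree_X_pow]
    exact N.lt_succ_self
  obtain ⟨R₁, _, φ₁, s, hs, h₁⟩ := exists_root_extension (monic_X_pow (R := k) (N + 1))
  have : Nontrivial R₁ := nontrivial_of_ne 1 0 fun h =>
    one_ne_zero (α := k) (h₁ N hdeg 1 (by rw [map_one, h, zero_mul]))
  obtain ⟨R₂, _, φ₂, t, ht, h₂⟩ := exists_root_extension (monic_X_pow (R := R₁) (N + 1))
  have : Nontrivial R₂ := nontrivial_of_ne 1 0 fun h =>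
    one_ne_zero (α := R₁) (h₂ N hdeg 1 (by rw [map_one, h, zero_mul]))
  obtain ⟨R₃, _, φ₃, z, hz, h₃⟩ := exists_root_extension
    (monic_X_pow_add_C (φ₂ s ^ 3 + t ^ 3) (n := 3) (by norm_num))
  rw [eval₂_X_pow] at hs ht
  rw [eval₂_add, eval₂_X_pow, eval₂_C] at hz
  refine ⟨R₃, inferInstance, ((φ₃.comp φ₂).comp φ₁).toAlgebra, φ₃ (φ₂ s), φ₃ t, z, ?_, ?_, ?_,
    fun h => ?_⟩
  · rw [← map_pow, ← map_pow, hs, map_zero, map_zero]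
  · rw [← map_pow, ht, map_zero]
  · rw [← hz, map_add, map_pow, map_pow]
    ring
  · have h4 := h₃ 2 (by rw [natDegree_X_pow_add_C]; norm_num) (φ₂ s ^ N * t ^ N) (by
      rw [← h, map_mul, map_pow, map_pow]
      ring)
    rw [← map_pow] at h4
    have h5 := h₂ N hdeg _ h4
    refine one_ne_zero (α := k) (h₁ N hdeg _ ?_)
    rw [map_one, one_mul, h5]

/-- A cubic surface that is projectively equivalent to the Fermat surface is not Frobenius split. -/
theorem not_isFrobeniusSplit_of_aeval_eq_fermat {k : Type u} [Field k] [CharP k 2]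
    {f : MvPolynomial (Fin 4) k} (hf : f.IsHomogeneous 3) (P : GL (Fin 4) k)
    (hP : MvPolynomial.aeval (fun i => ∑ j, MvPolynomial.C ((P : Matrix (Fin 4) (Fin 4) k) i j) *
      MvPolynomial.X j) f = fermat k) : ¬ IsFrobeniusSplit 2 (surface f hf) := by
  intro h
  let := coordGradedAlgebra f hf
  -- the linear change of coordinates with matrix `M`; the `i`-th entry of `lin P⁻¹` is the linear
  -- form that becomes `xᵢ`
  let lin (M : Matrix (Fin 4) (Fin 4) k) (i : Fin 4) : MvPolynomial (Fin 4) k :=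
    ∑ j, MvPolynomial.C (M i j) * MvPolynomial.X j
  have hlin : ∀ M N i, MvPolynomial.aeval (lin N) (lin M i) = lin (M * N) i := by
    intro M N i
    simp only [lin, map_sum, map_mul, MvPolynomial.aeval_C, MvPolynomial.aeval_X, Finset.mul_sum,
      Matrix.mul_apply, Finset.sum_mul, MvPolynomial.algebraMap_eq]
    rw [Finset.sum_comm]
    exact Finset.sum_congr rfl fun _ _ => Finset.sum_congr rfl fun _ _ => by ring
  have hone : ∀ i, lin 1 i = MvPolynomial.X i := by
    intro i
    simp [lin, Matrix.one_apply]
  have hsum : MvPolynomial.aeval (lin ↑P⁻¹) (fermat k) = f := by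
    rw [← hP, ← AlgHom.comp_apply, MvPolynomial.comp_aeval]
    have : (fun i => MvPolynomial.aeval (lin ↑P⁻¹) (lin P i)) = MvPolynomial.X := by
      funext i
      rw [hlin, ← Matrix.GeneralLinearGroup.coe_mul, mul_inv_cancel,
        Matrix.GeneralLinearGroup.coe_one, hone]
    exact (congrArg (fun v => MvPolynomial.aeval v f) this).trans
      (by rw [MvPolynomial.aeval_X_left, AlgHom.id_apply])
  let mk := Ideal.Quotient.mkₐ k (Ideal.span {f})
  obtain ⟨N, x, y, z, hxyz⟩ := IsFrobeniusSplit.exists_eq_add (𝒜 := coordGrading f) h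
    (by
      have : (2 : k) = 0 := CharTwo.two_eq_zero
      have := congrArg (algebraMap k (MvPolynomial (Fin 4) k ⧸ Ideal.span {f})) this
      rwa [map_ofNat, map_zero] at this)
    (l := fun i => mk (lin ↑P⁻¹ i))
    (fun i => mk_mem_coordGrading f (MvPolynomial.IsHomogeneous.sum _ _ _ fun j _ => by
      simpa using (MvPolynomial.isHomogeneous_C _ _).mul (MvPolynomial.isHomogeneous_X _ _)))
    (by
      have h0 : mk f = 0 := Ideal.Quotient.eq_zero_iff_mem.mpr (Ideal.mem_span_singleton_self f)
      replace h0 := (congrArg mk hsum).trans h0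
      simpa [fermat] using h0)
  obtain ⟨R, _, _, s, t, w, hs, ht, hst, hne⟩ := exists_fermat_algebra k N
  -- the values of the coordinates in the algebra, after the change of coordinates
  let v : Fin 4 → R := ![0, s, t, w]
  let ψ : MvPolynomial (Fin 4) k →ₐ[k] R := (MvPolynomial.aeval v).comp (MvPolynomial.aeval (lin P))
  have hψ : ∀ p ∈ Ideal.span {f}, ψ p = 0 := by
    intro p hp
    obtain ⟨c, rfl⟩ := Ideal.mem_span_singleton'.mp hp
    have : ψ f = 0 := by
      change MvPolynomial.aeval v (MvPolynomial.aeval (lin P) f) = 0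
      rw [hP]
      simpa [fermat, Fin.sum_univ_four, v] using hst
    rw [map_mul, this, mul_zero]
  let Ψ := Ideal.Quotient.liftₐ (Ideal.span {f}) ψ hψ
  have hΨ : ∀ i, Ψ (mk (lin ↑P⁻¹ i)) = v i := by
    intro i
    change MvPolynomial.aeval v (MvPolynomial.aeval (lin P) (lin ↑P⁻¹ i)) = _
    rw [hlin, ← Matrix.GeneralLinearGroup.coe_mul, inv_mul_cancel,
      Matrix.GeneralLinearGroup.coe_one, hone, MvPolynomial.aeval_X]
  have := congrArg Ψ hxyz
  simp only [map_mul, map_add, map_pow, hΨ] at this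
  apply hne
  simpa [v, hs, ht] using this

end CubicSurface

/-! ### Smoothness of the Fermat surface, and the classification -/

namespace CubicSurface

theorem isSmooth_fermat (k : Type u) [Field k] [CharP k 2] : IsSmooth (fermat k) := by
  intro v hv _
  obtain ⟨i, hi⟩ := Function.ne_iff.mp hv
  refine ⟨i, ?_⟩
  have h3 : (3 : k) = 1 := by
    linear_combination (CharTwo.two_eq_zero : (2 : k) = 0)
  have : MvPolynomial.eval v (MvPolynomial.pderiv i (fermat k)) = v i ^ 2 := by
    rw [fermat, map_sum, Finset.sum_eq_single i]
    · simp [Derivation.leibniz_pow, h3]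
    · intro j _ hj
      simp [Derivation.leibniz_pow, MvPolynomial.pderiv_X_of_ne hj]
    · simp
  rw [this]
  exact pow_ne_zero 2 hi

theorem aeval_one_matrix {k : Type u} [Field k] (f : MvPolynomial (Fin 4) k) :
    MvPolynomial.aeval (fun i => ∑ j, MvPolynomial.C (((1 : GL (Fin 4) k) :
      Matrix (Fin 4) (Fin 4) k) i j) * MvPolynomial.X j) f = f := by
  have : (fun i => ∑ j, MvPolynomial.C (((1 : GL (Fin 4) k) : Matrix (Fin 4) (Fin 4) k) i j) *
      MvPolynomial.X j) = (MvPolynomial.X : Fin 4 → MvPolynomial (Fin 4) k) := by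
    funext i
    simp [Matrix.one_apply]
  rw [this, MvPolynomial.aeval_X_left, AlgHom.id_apply]

end CubicSurface

theorem corollary5p2 (k : Type u) [Field k] [IsAlgClosed k] [CharP k 2] :
    (∀ (f : MvPolynomial (Fin 4) k) (hf : f.IsHomogeneous 3), CubicSurface.IsSmooth f →
      (CubicSurface.IsFrobeniusSplit 2 (CubicSurface.surface f hf) ↔
        ¬ CubicSurface.IsTriangleFree f)) ∧
    (CubicSurface.IsSmooth (CubicSurface.fermat k) ∧
      ¬ CubicSurface.IsFrobeniusSplit 2
        (CubicSurface.surface (CubicSurface.fermat k) (CubicSurface.fermat_isHomogeneous k))) ∧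
    (∀ (f : MvPolynomial (Fin 4) k) (hf : f.IsHomogeneous 3), CubicSurface.IsSmooth f →
      ¬ CubicSurface.IsFrobeniusSplit 2 (CubicSurface.surface f hf) →
        CubicSurface.ProjectivelyEquivalent f (CubicSurface.fermat k)) := by
  refine ⟨fun f hf hs => ?_, ⟨CubicSurface.isSmooth_fermat k,
    CubicSurface.not_isFrobeniusSplit_of_aeval_eq_fermat _ 1 (CubicSurface.aeval_one_matrix _)⟩,
    fun f hf hs hsplit => ?_⟩
  · obtain ⟨a, t, rfl⟩ := CubicSurface.exists_cubicForm hf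
    by_cases ht : t = 0
    · subst ht
      obtain ⟨P, hP⟩ := hs.exists_aeval_eq_fermat
      exact iff_of_false (CubicSurface.not_isFrobeniusSplit_of_aeval_eq_fermat hf P hP)
        (not_not_intro hs.isTriangleFree)
    · exact iff_of_true (CubicSurface.isFrobeniusSplit_cubicForm a ht hf)
        (hs.not_isTriangleFree ht)
  · obtain ⟨a, t, rfl⟩ := CubicSurface.exists_cubicForm hf
    obtain rfl : t = 0 := by
      by_contra ht
      exact hsplit (CubicSurface.isFrobeniusSplit_cubicForm a ht hf)
    obtain ⟨P, hP⟩ := hs.exists_aeval_eq_fermat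
    exact ⟨P, 1, by rw [hP]; simp⟩
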